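/- Let $X\subseteq\{0,1\}^n$ and let $f:X\to\{0,1\}$ be non-constant. An $f$-deciding vector set is a family $\{|v_{x,j}\rangle\in\mathbb{C}^m\}_{x\in X,\,j\in[n]}$ with $\sum_{j:x_j\ne y_j}\langle v_{x,j}|v_{y,j}\rangle=1$ whenever $f(x)\ne f(y)$. Its size is $A=\max_{x}\sum_j\||v_{x,j}\rangle\|^2$ and its maximum rank is $\kappa=\max_j\operatorname{rank}\{|v_{x,j}\rangle:f(x)=1\}$. Assume $A=O(n)$. Replace each $|v_{x,j}\rangle$ by the real vector $\operatorname{Re}|v_{x,j}\rangle\oplus\operatorname{Im}|v_{x,j}\rangle\in\mathbb{R}^{2m}$, still written $|v_{x,j}\rangle$, and for $f(y)=1$ put, with $c=100$, $$|\psi_y\rangle=\frac1{\sqrt{\nu_y}}\Big(|\hat 0\rangle+\frac1{\sqrt{cA}}\sum_{i\in[n]}|i\rangle|v_{y,i}\rangle|y_i\rangle\Big)\in\mathbb{C}\oplus\mathbb{C}^n\otimes\mathbb{C}^{2m}\otimes\mathbb{C}^2,\qquad \nu_y=1+\frac1{cA}\sum_i\||v_{y,i}\rangle\|^2 .$$ Let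 $\kappa_\psi$ be the rank of $\{|\psi_y\rangle:f(y)=1\}$. For $S\in\mathbb{R}^{N\times 2m}$ let $|\psi_y'\rangle=(|\hat 0\rangle\langle\hat 0|+I\otimes S\otimes I)|\psi_y\rangle$, let $\Delta'$ be the orthogonal projector onto $\operatorname{span}\{|\psi_y'\rangle:f(y)=1\}$, let $\Pi_x=|\hat 0\rangle\langle\hat 0|+\sum_i|i\rangle\langle i|\otimes I\otimes|x_i\rangle\langle x_i|$, and let $U_x=(2\Pi_x-I)(2\Delta'-I)$. Then there are integers $M=O(A)$ and $N=O\big((\kappa_\psi^2+A^4\kappa_\psi)\log(|X|n)\big)$ such that, if $S$ is a Johnson–Lindenstrauss matrix with independent $N(0,1/N)$ entries, then with probability at least $9/10$ over $S$ the following holds. There is a quantum query algorithm $U_TO_x\cdots U_1O_xU_0|\mathrm{init}\rangle$, followed by a two-outcome measurement, where $O_x|i\rangle|b\rangle=|i\rangle|b\oplus x_i\rangle$, that 1. outputs $1$ on each input $x$ with exactly the probability that phase estimation of $U_x$ on the initial state $|\hat 0\rangle$, with an $M$-dimensional phase register, measures the phase $0$; 2. outputs $f(x)$ with probability at least $2/3$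 for every $x\in X$; 3. uses $T=O(A)$ queries; and 4. uses $O(\log(2\kappa n))$ qubits. The constants in the bounds on $M$, $N$ and $T$ are universal. The constant in the bound on the number of qubits depends only on the constant in $A=O(n)$. -/

import Mathlib

open scoped NNReal ENNReal
open MeasureTheory ProbabilityTheory

noncomputable section

/-! ### The quantum query model -/

/-- A quantum query algorithm for inputs of `n` bits. Its Hilbert space has the orthonormal basis
`|i⟩|b⟩|w⟩`, where `|i⟩|b⟩` is the register on which the oracle acts and `w` ranges over a finite
work space. The algorithm runs `U_T O_x U_{T-1} O_x ⋯ U_1 O_x U_0 |init⟩` with `T = queries`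
(only the unitaries with index at most `T` are used), measures in the computational basis, and
outputs `1` exactly when the result lies in `accept`. -/
structure QueryAlgorithm (n : ℕ) where
  W : Type
  [fintypeW : Fintype W]
  [decEqW : DecidableEq W]
  queries : ℕ
  unitary : ℕ → Matrix.unitaryGroup (Fin n × Bool × W) ℂ
  init : Fin n × Bool × W
  accept : Finset (Fin n × Bool × W)

attribute [instance] QueryAlgorithm.fintypeW QueryAlgorithm.decEqW

/-- The oracle `O_x |i⟩|b⟩|w⟩ = |i⟩|b ⊕ x_i⟩|w⟩`, acting on amplitudes. -/
def oracle {n : ℕ} {W : Type} (x : Fin n → Bool) (ψ : Fin n × Bool × W → ℂ) :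
    Fin n × Bool × W → ℂ :=
  fun s => ψ (s.1, xor s.2.1 (x s.1), s.2.2)

namespace QueryAlgorithm

variable {n : ℕ} (Q : QueryAlgorithm n)

/-- The state `U_t O_x ⋯ O_x U_0 |init⟩` reached after `t` queries. -/
def state (x : Fin n → Bool) : ℕ → (Fin n × Bool × Q.W → ℂ)
  | 0 => (Q.unitary 0 : Matrix _ _ ℂ).mulVec (Pi.single Q.init 1)
  | t + 1 => (Q.unitary (t + 1) : Matrix _ _ ℂ).mulVec (oracle x (state x t))

/-- The probability that the algorithm outputs the bit `b` on input `x`. -/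
def outputProb (x : Fin n → Bool) (b : Bool) : ℝ :=
  ∑ s, if decide (s ∈ Q.accept) = b then ‖Q.state x Q.queries s‖ ^ 2 else 0

/-- The number of qubits: the least `q` such that the Hilbert space has dimension at most `2 ^ q`. -/
def qubits : ℕ := Nat.clog 2 (Fintype.card (Fin n × Bool × Q.W))

end QueryAlgorithm

/-! ### Deciding vector sets -/

section Deciding

variable {n m : ℕ} {X : Finset (Fin n → Bool)}

/-- `v` is an `f`-deciding vector set:
`∑_{j : x_j ≠ y_j} ⟨v_{x,j}, v_{y,j}⟩ = 1` whenever `f x ≠ f y`. -/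
def IsDeciding (f : X → Bool) (v : X → Fin n → EuclideanSpace ℂ (Fin m)) : Prop :=
  ∀ x y : X, f x ≠ f y →
    ∑ j, (if x.1 j ≠ y.1 j then inner ℂ (v x j) (v y j) else 0) = 1

/-- The size `max_x ∑_j ‖v_{x,j}‖²`. -/
def vsSize (v : X → Fin n → EuclideanSpace ℂ (Fin m)) : ℝ :=
  ⨆ x : X, ∑ j, ‖v x j‖ ^ 2

/-- The maximum rank `max_j rank {v_{x,j} : f(x) = 1}`. -/
def maxRank (f : X → Bool) (v : X → Fin n → EuclideanSpace ℂ (Fin m)) : ℕ :=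
  Finset.univ.sup fun j : Fin n =>
    Module.finrank ℂ (Submodule.span ℂ {u | ∃ x : X, f x = true ∧ u = v x j})

/-- The real vectors `Re v_{x,j} ⊕ Im v_{x,j}` of dimension `2m`. -/
def realify (v : X → Fin n → EuclideanSpace ℂ (Fin m)) : X → Fin n → (Fin m ⊕ Fin m) → ℝ :=
  fun x j => Sum.elim (fun k => (v x j k).re) (fun k => (v x j k).im)

end Deciding

/-! ### The dual adversary unitary and its compression -/

/-- The space `ℂ ⊕ (ℂ^n ⊗ ℂ^ι ⊗ ℂ^2)`. The basis vector of `none` is `|0̂⟩`, and that of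
`some (i, k, b)` is `|i⟩|k⟩|b⟩`. The inner register is the one indexed by `ι`. -/
abbrev AdvSpace (n : ℕ) (ι : Type) := EuclideanSpace ℂ (Option (Fin n × ι × Bool))

/-- The vector `|0̂⟩`. -/
def zeroHat (n : ℕ) (ι : Type) [Fintype ι] [DecidableEq ι] : AdvSpace n ι :=
  EuclideanSpace.single none 1

/-- `|ψ_y⟩ = ν_y^{-1/2} (|0̂⟩ + (c A)^{-1/2} ∑_i |i⟩ |u_i⟩ |y_i⟩)`, with
`ν_y = 1 + (c A)^{-1} ∑_i ‖u_i‖²`, for the real vectors `u_i` that belong to the input `y`. -/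
def psiVec {n : ℕ} {ι : Type} [Fintype ι] (c A : ℝ) (y : Fin n → Bool) (u : Fin n → ι → ℝ) :
    AdvSpace n ι :=
  let ν : ℝ := 1 + (c * A)⁻¹ * ∑ i, ∑ k, u i k ^ 2
  WithLp.toLp 2 fun s =>
    match s with
    | none => (((√ν)⁻¹ : ℝ) : ℂ)
    | some (i, k, b) => if b = y i then (((√ν)⁻¹ * (√(c * A))⁻¹ * u i k : ℝ) : ℂ) else 0

/-- The compression `|0̂⟩⟨0̂| + I ⊗ S ⊗ I`, which applies the real matrix `S` to the inner
register only. -/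
def compress {n N : ℕ} {ι : Type} [Fintype ι] (S : Fin N → ι → ℝ) (ψ : AdvSpace n ι) :
    AdvSpace n (Fin N) :=
  WithLp.toLp 2 fun s =>
    match s with
    | none => ψ none
    | some (i, a, b) => ∑ k, (S a k : ℂ) * ψ (some (i, k, b))

/-- The projector `Π_x = |0̂⟩⟨0̂| + ∑_i |i⟩⟨i| ⊗ I ⊗ |x_i⟩⟨x_i|`. -/
def inputProj {n : ℕ} {ι : Type} [Fintype ι] [DecidableEq ι] (x : Fin n → Bool) :
    AdvSpace n ι →L[ℂ] AdvSpace n ι :=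
  Matrix.toEuclideanCLM (n := Option (Fin n × ι × Bool)) (𝕜 := ℂ) <| Matrix.diagonal fun s =>
    match s with
    | none => 1
    | some (i, _, b) => if b = x i then 1 else 0

section Compressed

variable {n m N : ℕ} {X : Finset (Fin n → Bool)}

/-- The vectors `|ψ_y⟩`, `f(y) = 1`, of the realified vector set, where `A` is the size. -/
def psiSet (c : ℝ) (f : X → Bool) (v : X → Fin n → EuclideanSpace ℂ (Fin m)) :
    Set (AdvSpace n (Fin m ⊕ Fin m)) :=
  {ψ | ∃ y : X, f y = true ∧ ψ = psiVec c (vsSize v) y.1 (realify v y)}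

/-- The rank of the vectors `|ψ_y⟩`, `f(y) = 1`. -/
def psiRank (c : ℝ) (f : X → Bool) (v : X → Fin n → EuclideanSpace ℂ (Fin m)) : ℕ :=
  Module.finrank ℂ (Submodule.span ℂ (psiSet c f v))

/-- The unitary `U_x = (2 Π_x - I)(2 Δ - I)` of the compressed vector set, where `Δ` is the
orthogonal projector onto the span of the compressed vectors `compress S |ψ_y⟩`, `f(y) = 1`. -/
def compressedUnitary (c : ℝ) (f : X → Bool) (v : X → Fin n → EuclideanSpace ℂ (Fin m))
    (S : Fin N → (Fin m ⊕ Fin m) → ℝ) (x : Fin n → Bool) :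
    AdvSpace n (Fin N) →L[ℂ] AdvSpace n (Fin N) :=
  ((2 : ℂ) • inputProj x - 1) *
    ((2 : ℂ) • (Submodule.span ℂ (compress S '' psiSet c f v)).starProjection - 1)

end Compressed

/-- Phase estimation of `U` on `ψ` with an `M`-dimensional phase register: the register is prepared
in the uniform superposition, `U ^ k` is applied controlled on `|k⟩`, and the inverse Fourier
transform of `ℤ/M` is applied to the register. This is the probability of then measuring `l`,
that is, of measuring the phase `2 π l / M`. -/
def phaseEstProb {E : Type*} [NormedAddCommGroup E] [NormedSpace ℂ E] (M : ℕ) (U : E →L[ℂ] E)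
    (ψ : E) (l : ℕ) : ℝ :=
  ‖(M : ℂ)⁻¹ • ∑ k ∈ Finset.range M,
    Complex.exp (-(2 * Real.pi * Complex.I * k * l / M)) • (U ^ k) ψ‖ ^ 2

/-- The law of a Gaussian Johnson–Lindenstrauss matrix: `N × ι` independent entries, each normal
with mean `0` and variance `1 / N`. -/
def jlMeasure (N : ℕ) (ι : Type) [Fintype ι] : Measure (Fin N → ι → ℝ) :=
  Measure.pi fun _ => Measure.pi fun _ => gaussianReal 0 ((N : ℝ≥0)⁻¹)

end

/-! Phase estimation succeeds because of two witnesses, and it is enough that a random `S` preserves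
finitely many of their inner products. If `f x = 1`, then `|ψ_x'⟩` lies in the span and is fixed by
`Π_x`, hence by `U_x`. Its overlap with `|0̂⟩` is untouched by `S`, its norm is close to `1`, and
`ν_x ≤ 1.01`, so phase `0` is likely (`norm_inner_sq_le_phaseEstProb`). If `f x = 0`, the vector
`|φ_x⟩` (`phiVec`) satisfies `Π_x φ_x = |0̂⟩`, has norm `O(A)`, and is orthogonal to every `ψ_y`
with `f y = 1`, which is the deciding condition. Compression commutes with `Π_x`, so `Π_x φ_x' =
|0̂⟩` still holds exactly; only the orthogonality becomes approximate. An effective spectral gap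
estimate (`phaseEstProb_twoReflections_le`) bounds the probability of phase `0` by `(‖φ_x'‖ / M +
‖Δ' φ_x'‖)²`, where `M ≥ 100 A` controls the first term. The second term is controlled by
`norm_sq_starProjection_map_le`: if `S` preserves the Gram matrix of an orthonormal basis of the
`κ_ψ`-dimensional span up to error `1 / (2 κ_ψ)`, and the inner products of that basis with `φ_x`,
then `Δ' φ_x'` is small. Chernoff bounds for Gaussian quadratic forms and a union bound over `O(n
|X|²)` real inner products give all of this with high probability
(`jlMeasure_not_preservesInner_le`). The circuit uses that `2 Π_x - I` is a sign flip between two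
oracle calls and that `2 Δ' - I` needs none. The qubit count follows from `κ_ψ ≤ 1 + 4 n κ`: all
dimensions are polynomial in `κ n`. -/

noncomputable section

/-! ### Gates -/

section Gates

variable {B : Type} [Fintype B] [DecidableEq B]

/-- A map on amplitudes that is given by a unitary matrix. -/
def IsGate (L : (B → ℂ) → (B → ℂ)) : Prop :=
  ∃ U : Matrix.unitaryGroup B ℂ, ∀ ψ, (U : Matrix B B ℂ).mulVec ψ = L ψ

lemma IsGate.comp {L L' : (B → ℂ) → (B → ℂ)} (h : IsGate L) (h' : IsGate L') :
    IsGate fun ψ => L (L' ψ) := by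
  obtain ⟨U, hU⟩ := h
  obtain ⟨U', hU'⟩ := h'
  exact ⟨U * U', fun ψ => by simp [← hU', ← hU, Matrix.mulVec_mulVec]⟩

/-- By polarization a norm-preserving map preserves inner products, so its columns are orthonormal.
-/
lemma isGate_of_norm (L : (B → ℂ) →ₗ[ℂ] (B → ℂ))
    (h : ∀ ψ, ∑ s, ‖L ψ s‖ ^ 2 = ∑ s, ‖ψ s‖ ^ 2) : IsGate L := by
  let E := EuclideanSpace ℂ B
  let F : E →ₗ[ℂ] E := (WithLp.linearEquiv 2 ℂ (B → ℂ)).symm.toLinearMap ∘ₗ L ∘ₗ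
    (WithLp.linearEquiv 2 ℂ (B → ℂ)).toLinearMap
  have hF : ∀ z : E, ‖F z‖ = ‖z‖ := fun z => by
    rw [EuclideanSpace.norm_eq, EuclideanSpace.norm_eq]
    exact congrArg _ (h z)
  let Li : E →ₗᵢ[ℂ] E := ⟨F, hF⟩
  have key : ∀ i j : B, ∑ k, star (L (Pi.single i 1) k) * L (Pi.single j 1) k
      = if i = j then 1 else 0 := fun i j => by
    have h1 := Li.inner_map_map (EuclideanSpace.single i (1 : ℂ)) (EuclideanSpace.single j 1)
    rw [EuclideanSpace.inner_single_left] at h1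
    simp only [map_one, one_mul, PiLp.single_apply] at h1
    rw [← h1]
    refine Finset.sum_congr rfl fun k _ => ?_
    rw [mul_comm]
    rfl
  refine ⟨⟨LinearMap.toMatrix' L, ?_⟩, fun ψ => ?_⟩
  · rw [Matrix.mem_unitaryGroup_iff']
    ext i j
    rw [Matrix.mul_apply, Matrix.one_apply, ← key i j]
    refine Finset.sum_congr rfl fun k _ => ?_
    rw [Matrix.star_apply, LinearMap.toMatrix'_apply, LinearMap.toMatrix'_apply]
  · exact LinearMap.toMatrix'_mulVec L ψ

lemma sum_norm_sq_mulVec (U : Matrix.unitaryGroup B ℂ) (ψ : B → ℂ) :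
    ∑ s, ‖(U : Matrix B B ℂ).mulVec ψ s‖ ^ 2 = ∑ s, ‖ψ s‖ ^ 2 := by
  have key : ∀ φ : B → ℂ, ((∑ s, ‖φ s‖ ^ 2 : ℝ) : ℂ) = star φ ⬝ᵥ φ := fun φ => by
    simp only [dotProduct, Pi.star_apply, Complex.ofReal_sum, Complex.ofReal_pow]
    exact Finset.sum_congr rfl fun s _ => (Complex.conj_mul' (φ s)).symm
  apply Complex.ofReal_injective
  rw [key, key, Matrix.star_mulVec, ← Matrix.dotProduct_mulVec, Matrix.mulVec_mulVec]
  have := Matrix.mem_unitaryGroup_iff'.1 U.2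
  rw [Matrix.star_eq_conjTranspose] at this
  rw [this, Matrix.one_mulVec]

/-- There is a unitary matrix whose first column is constant. -/
lemma exists_unitary_uniform_column {M : ℕ} [NeZero M] :
    ∃ H : Matrix.unitaryGroup (Fin M) ℂ, ∀ k,
      (H : Matrix (Fin M) (Fin M) ℂ) k 0 = (((√M)⁻¹ : ℝ) : ℂ) := by
  let u : EuclideanSpace ℂ (Fin M) := WithLp.toLp 2 fun _ => (((√M)⁻¹ : ℝ) : ℂ)
  have hM : (0 : ℝ) < M := Nat.cast_pos.2 (NeZero.pos M)
  have hu : ‖u‖ = 1 := by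
    rw [EuclideanSpace.norm_eq, Real.sqrt_eq_one]
    simp only [u, Complex.norm_real, Finset.sum_const, Finset.card_univ, Fintype.card_fin,
      nsmul_eq_mul, norm_inv, Real.norm_eq_abs, sq_abs, inv_pow, Real.sq_sqrt hM.le]
    exact mul_inv_cancel₀ hM.ne'
  obtain ⟨b, hb⟩ := Orthonormal.exists_orthonormalBasis_extension_of_card_eq (𝕜 := ℂ)
    (E := EuclideanSpace ℂ (Fin M)) (ι := Fin M) (by simp) (v := fun _ => u) (s := {0})
    (by
      constructor
      · intro i; exact hu
      · intro i j hij; exact absurd (Subsingleton.elim i j) hij)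
  refine ⟨⟨(EuclideanSpace.basisFun (Fin M) ℂ).toBasis.toMatrix b.toBasis, ?_⟩, fun k => ?_⟩
  · simpa using (EuclideanSpace.basisFun (Fin M) ℂ).toMatrix_orthonormalBasis_mem_unitary b
  · have := hb 0 rfl
    simp [Module.Basis.toMatrix_apply, this, u]

end Gates

/-! ### Total output probability -/

namespace QueryAlgorithm

lemma sum_norm_sq_state {n : ℕ} (Q : QueryAlgorithm n) (x : Fin n → Bool) (t : ℕ) :
    ∑ s, ‖Q.state x t s‖ ^ 2 = 1 := by
  induction t with
  | zero =>
    rw [state, sum_norm_sq_mulVec, Finset.sum_eq_single Q.init]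
    · simp
    · intro s _ hs; simp [hs]
    · simp
  | succ t ih =>
    rw [state, sum_norm_sq_mulVec, ← ih]
    refine Fintype.sum_bijective (fun s => (s.1, xor s.2.1 (x s.1), s.2.2)) ?_ _ _ fun s => rfl
    exact Function.Involutive.bijective fun s => by simp

lemma outputProb_add {n : ℕ} (Q : QueryAlgorithm n) (x : Fin n → Bool) :
    Q.outputProb x true + Q.outputProb x false = 1 := by
  rw [outputProb, outputProb, ← Finset.sum_add_distrib, ← sum_norm_sq_state Q x Q.queries]
  refine Finset.sum_congr rfl fun s _ => ?_
  by_cases h : s ∈ Q.accept <;> simp [h]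

end QueryAlgorithm

/-! ### Coordinates of the projectors -/

section InputProj

variable {n : ℕ} {ι : Type} [Fintype ι] [DecidableEq ι] (x : Fin n → Bool) (φ : AdvSpace n ι)

@[simp] lemma inputProj_none : inputProj x φ none = φ none := by
  simp [inputProj, Matrix.mulVec_diagonal]

@[simp] lemma inputProj_some (i : Fin n) (k : ι) (b : Bool) :
    inputProj x φ (some (i, k, b)) = if b = x i then φ (some (i, k, b)) else 0 := by
  simp [inputProj, Matrix.mulVec_diagonal]

end InputProj

/-! ### Simulation of phase estimation by a query algorithm -/

section Simulation

variable {n M N : ℕ}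

/-- The basis of the query algorithm with an `M`-dimensional phase register and work space
`Option (Fin N)`. -/
abbrev SimBasis (n M N : ℕ) := Fin n × Bool × (Fin M × Option (Fin N))

/-- The basis of a slice with a fixed value of the phase register. -/
abbrev SliceBasis (n N : ℕ) := Fin n × Bool × Option (Fin N)

lemma sum_simBasis (F : SimBasis n M N → ℝ) :
    ∑ s, F s = ∑ k, ∑ r : SliceBasis n N, F (r.1, r.2.1, (k, r.2.2)) := by
  rw [← Fintype.sum_prod_type']
  exact Fintype.sum_equiv
    ⟨fun s => (s.2.2.1, (s.1, s.2.1, s.2.2.2)), fun p => (p.2.1, p.2.2.1, (p.1, p.2.2.2)),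
      fun _ => rfl, fun _ => rfl⟩ _ _ fun _ => rfl

/-- The embedding of the adversary space into a slice; `|0̂⟩` goes to `|i₀⟩|0⟩|none⟩`. -/
def embedSlice (i₀ : Fin n) :
    AdvSpace n (Fin N) →ₗᵢ[ℂ] EuclideanSpace ℂ (SliceBasis n N) where
  toFun φ := WithLp.toLp 2 fun s => s.2.2.elim
    (if s.1 = i₀ ∧ s.2.1 = false then φ none else 0) fun a => φ (some (s.1, a, s.2.1))
  map_add' φ φ' := by
    ext ⟨i, b, w⟩
    cases w with
    | none => by_cases h : i = i₀ ∧ b = false <;> simp [h]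
    | some a => simp
  map_smul' c φ := by
    ext ⟨i, b, w⟩
    cases w with
    | none => by_cases h : i = i₀ ∧ b = false <;> simp [h]
    | some a => simp
  norm_map' φ := by
    simp only [EuclideanSpace.norm_eq, LinearMap.coe_mk, AddHom.coe_mk]
    congr 1
    simp only [Fintype.sum_prod_type, Fintype.sum_option, Option.elim_none, Option.elim_some,
      Finset.sum_add_distrib]
    congr 1
    · rw [Finset.sum_eq_single i₀ (fun i _ hi => by simp [hi]) (by simp)]
      simp
    · exact Finset.sum_congr rfl fun i _ => Finset.sum_comm

@[simp] lemma embedSlice_none (i₀ : Fin n) (φ : AdvSpace n (Fin N)) (i : Fin n) (b : Bool) :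
    embedSlice i₀ φ (i, b, none) = if i = i₀ ∧ b = false then φ none else 0 := rfl

@[simp] lemma embedSlice_some (i₀ : Fin n) (φ : AdvSpace n (Fin N)) (i : Fin n) (b : Bool)
    (a : Fin N) : embedSlice i₀ φ (i, b, some a) = φ (some (i, a, b)) := rfl

/-- The amplitudes of the state `∑_k |k⟩ |φ_k⟩`. -/
def packState (i₀ : Fin n) (φ : Fin M → AdvSpace n (Fin N)) : SimBasis n M N → ℂ :=
  fun s => embedSlice i₀ (φ s.2.2.1) (s.1, s.2.1, s.2.2.2)

/-- Applies a linear map to each slice. -/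
def sliceMap (g : Fin M → (SliceBasis n N → ℂ) →ₗ[ℂ] (SliceBasis n N → ℂ)) :
    (SimBasis n M N → ℂ) →ₗ[ℂ] (SimBasis n M N → ℂ) where
  toFun ψ s := g s.2.2.1 (fun r => ψ (r.1, r.2.1, (s.2.2.1, r.2.2))) (s.1, s.2.1, s.2.2.2)
  map_add' ψ ψ' := by
    ext s
    exact congrFun ((g s.2.2.1).map_add _ _) _
  map_smul' c ψ := by
    ext s
    exact congrFun ((g s.2.2.1).map_smul _ _) _

lemma sliceMap_apply (g : Fin M → (SliceBasis n N → ℂ) →ₗ[ℂ] (SliceBasis n N → ℂ))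
    (ψ : SimBasis n M N → ℂ) (i : Fin n) (b : Bool) (k : Fin M) (w : Option (Fin N)) :
    sliceMap g ψ (i, b, (k, w)) = g k (fun r => ψ (r.1, r.2.1, (k, r.2.2))) (i, b, w) := rfl

lemma isGate_sliceMap {g : Fin M → (SliceBasis n N → ℂ) →ₗ[ℂ] (SliceBasis n N → ℂ)}
    (hg : ∀ k ψ, ∑ s, ‖g k ψ s‖ ^ 2 = ∑ s, ‖ψ s‖ ^ 2) : IsGate (sliceMap g) := by
  refine isGate_of_norm _ fun ψ => ?_
  rw [sum_simBasis, sum_simBasis]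
  refine Finset.sum_congr rfl fun k _ => ?_
  simp only [sliceMap_apply]
  exact hg k fun r => ψ (r.1, r.2.1, (k, r.2.2))

/-- A linear isometry of Euclidean space, acting on amplitudes. -/
def amplitudeMap {B : Type} [Fintype B]
    (F : EuclideanSpace ℂ B →ₗᵢ[ℂ] EuclideanSpace ℂ B) : (B → ℂ) →ₗ[ℂ] (B → ℂ) :=
  (WithLp.linearEquiv 2 ℂ (B → ℂ)).toLinearMap ∘ₗ F.toLinearMap ∘ₗ
    (WithLp.linearEquiv 2 ℂ (B → ℂ)).symm.toLinearMap

lemma sum_norm_sq_amplitudeMap {B : Type} [Fintype B]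
    (F : EuclideanSpace ℂ B →ₗᵢ[ℂ] EuclideanSpace ℂ B) (ψ : B → ℂ) :
    ∑ s, ‖amplitudeMap F ψ s‖ ^ 2 = ∑ s, ‖ψ s‖ ^ 2 := by
  have h := congrArg (· ^ 2) (F.norm_map (WithLp.toLp 2 ψ))
  simp only [EuclideanSpace.norm_sq_eq] at h
  exact h

/-- The reflection about `V`, controlled on the phase register being larger than `t`. -/
def ctrlReflection (i₀ : Fin n) (V : Submodule ℂ (AdvSpace n (Fin N))) (t : ℕ) :
    (SimBasis n M N → ℂ) →ₗ[ℂ] (SimBasis n M N → ℂ) :=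
  sliceMap fun k => if t < (k : ℕ) then
    amplitudeMap (V.map (embedSlice i₀).toLinearMap).reflection.toLinearIsometry else LinearMap.id

lemma isGate_ctrlReflection (i₀ : Fin n) (V : Submodule ℂ (AdvSpace n (Fin N))) (t : ℕ) :
    IsGate (ctrlReflection (M := M) i₀ V t) := by
  refine isGate_sliceMap fun k ψ => ?_
  split_ifs
  · exact sum_norm_sq_amplitudeMap _ ψ
  · rfl

/-- The embedding is isometric but not onto. Reflecting about the image of `V` is unitary on the
whole slice and restricts to the reflection about `V` on the embedded space. -/
lemma ctrlReflection_packState (i₀ : Fin n) (V : Submodule ℂ (AdvSpace n (Fin N))) (t : ℕ)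
    (φ : Fin M → AdvSpace n (Fin N)) :
    ctrlReflection i₀ V t (packState i₀ φ) =
      packState i₀ fun k => if t < (k : ℕ) then ((2 : ℂ) • V.starProjection - 1) (φ k) else φ k := by
  ext ⟨i, b, k, w⟩
  by_cases h : t < (k : ℕ)
  · have key : (V.map (embedSlice i₀).toLinearMap).reflection (embedSlice i₀ (φ k))
        = embedSlice i₀ (((2 : ℂ) • V.starProjection - 1) (φ k)) := by
      rw [Submodule.reflection_apply, ← LinearIsometry.map_starProjection]
      simp [two_smul]
    have := congrArg (fun z : EuclideanSpace ℂ (SliceBasis n N) => z (i, b, w)) key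
    simp only [packState, h, if_true]
    rw [← this, ctrlReflection, sliceMap_apply, if_pos h]
    rfl
  · rw [ctrlReflection, sliceMap_apply, if_neg h]
    simp [h, packState]

/-- The sign flip of `|i⟩|1⟩|a⟩`, controlled on the phase register being larger than `t`. -/
def ctrlSign (t : ℕ) : (SimBasis n M N → ℂ) →ₗ[ℂ] (SimBasis n M N → ℂ) where
  toFun ψ s := (if t < (s.2.2.1 : ℕ) ∧ s.2.2.2.isSome ∧ s.2.1 = true then -1 else 1) * ψ s
  map_add' ψ ψ' := by ext s; simp [mul_add]
  map_smul' c ψ := by ext s; simp only [Pi.smul_apply, smul_eq_mul, RingHom.id_apply]; ring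

lemma isGate_ctrlSign (t : ℕ) : IsGate (ctrlSign (n := n) (M := M) (N := N) t) := by
  refine isGate_of_norm _ fun ψ => Finset.sum_congr rfl fun s _ => ?_
  simp only [ctrlSign, LinearMap.coe_mk, AddHom.coe_mk]
  split_ifs <;> simp

/-- Between the oracle calls the bit is `b ⊕ x_i`, so the flip gives the sign `+1` exactly when `b =
x_i`. The states with work register `none` get no sign, and the second call restores them. -/
lemma oracle_ctrlSign_oracle (i₀ : Fin n) (x : Fin n → Bool) (t : ℕ)
    (φ : Fin M → AdvSpace n (Fin N)) :
    oracle x (ctrlSign t (oracle x (packState i₀ φ))) =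
      packState i₀ fun k => if t < (k : ℕ) then
        ((2 : ℂ) • inputProj x - 1 : AdvSpace n (Fin N) →L[ℂ] _) (φ k) else φ k := by
  ext ⟨i, b, k, w⟩
  cases w with
  | none =>
    by_cases h : t < (k : ℕ)
    · simp only [oracle, ctrlSign, packState, h, LinearMap.coe_mk, AddHom.coe_mk]
      by_cases h' : i = i₀ ∧ b = false <;> simp [h', two_mul]
    · simp [oracle, ctrlSign, packState, h]
  | some a =>
    by_cases h : t < (k : ℕ)
    · simp only [oracle, ctrlSign, packState, h, LinearMap.coe_mk, AddHom.coe_mk]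
      cases hb : b <;> cases hx : x i <;> simp [hx, two_mul]
    · simp [oracle, ctrlSign, packState, h]

/-- A matrix acting on the phase register. -/
def phaseGate (H : Matrix (Fin M) (Fin M) ℂ) :
    (SimBasis n M N → ℂ) →ₗ[ℂ] (SimBasis n M N → ℂ) where
  toFun ψ s := H.mulVec (fun k => ψ (s.1, s.2.1, (k, s.2.2.2))) s.2.2.1
  map_add' ψ ψ' := by
    ext s
    exact congrFun (H.mulVec_add _ _) _
  map_smul' c ψ := by
    ext s
    exact congrFun (H.mulVec_smul _ _) _

lemma isGate_phaseGate (H : Matrix.unitaryGroup (Fin M) ℂ) :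
    IsGate (phaseGate (n := n) (N := N) (H : Matrix (Fin M) (Fin M) ℂ)) := by
  refine isGate_of_norm _ fun ψ => ?_
  rw [sum_simBasis, sum_simBasis, Finset.sum_comm, Finset.sum_comm (s := Finset.univ (α := Fin M))]
  exact Finset.sum_congr rfl fun r _ =>
    sum_norm_sq_mulVec H fun k => ψ (r.1, r.2.1, (k, r.2.2))

/-- For the outcome `0` only the first column of the Fourier matrix matters, so any unitary `H` with
constant first column can replace it. Round `t` applies `U` to the branches `k > t`, at two queries
per round. -/
theorem exists_queryAlgorithm_phaseEst (hn : 0 < n) (hM : 0 < M)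
    (V : Submodule ℂ (AdvSpace n (Fin N))) :
    ∃ Q : QueryAlgorithm n, Q.queries = 2 * M ∧
      Fintype.card (Fin n × Bool × Q.W) = n * (2 * (M * (N + 1))) ∧
      ∀ x, Q.outputProb x true = phaseEstProb M
        (((2 : ℂ) • inputProj x - 1) * ((2 : ℂ) • V.starProjection - 1))
        (zeroHat n (Fin N)) 0 := by
  have : NeZero M := ⟨hM.ne'⟩
  let i₀ : Fin n := ⟨0, hn⟩
  obtain ⟨H, hH⟩ := exists_unitary_uniform_column (M := M)
  set r : ℝ := (√M)⁻¹ with hr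
  obtain ⟨Up, hUp⟩ := (isGate_ctrlReflection (M := M) i₀ V 0).comp
    (isGate_phaseGate (n := n) (N := N) H)
  choose Ur hUr using fun t => isGate_ctrlReflection (M := M) i₀ V t
  choose Us hUs using fun t => isGate_ctrlSign (n := n) (M := M) (N := N) t
  obtain ⟨Uf, hUf⟩ := isGate_phaseGate (n := n) (N := N) (star H)
  let Q : QueryAlgorithm n :=
    { W := Fin M × Option (Fin N)
      queries := 2 * M
      -- Index `0` merges `H` with the reflection of round `0`. Odd indices are the sign flips,
      -- positive even ones the reflections of later rounds, and the last one undoes `H`.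
      unitary := fun j => if j = 2 * M then Uf else if j = 0 then Up else
        if j % 2 = 0 then Ur (j / 2) else Us (j / 2)
      init := (i₀, false, (0, none))
      accept := Finset.univ.filter fun s => s.2.2.1 = 0 }
  refine ⟨Q, rfl, by simp [Q], fun x => ?_⟩
  set U := ((2 : ℂ) • inputProj x - 1) * ((2 : ℂ) • V.starProjection - 1) with hU
  -- The invariant: after `t` rounds branch `k` carries `U ^ min k t`. As `k < M`, this is `U ^ k`
  -- after `M` rounds.
  let Φ : ℕ → SimBasis n M N → ℂ := fun t => packState i₀ fun k =>
    (r : ℂ) • (U ^ (min (k : ℕ) t)) (zeroHat n (Fin N))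
  have hΦ0 : phaseGate (H : Matrix (Fin M) (Fin M) ℂ) (Pi.single (i₀, false, (0, none)) 1)
      = Φ 0 := by
    ext ⟨i, b, k, w⟩
    have h1 : phaseGate (n := n) (N := N) (H : Matrix (Fin M) (Fin M) ℂ)
        (Pi.single (i₀, false, (0, none)) 1) (i, b, (k, w)) = ∑ k' : Fin M,
        (H : Matrix (Fin M) (Fin M) ℂ) k k' *
          Pi.single (M := fun _ : SimBasis n M N => ℂ) (i₀, false, (0, none)) 1 (i, b, (k', w)) :=
      rfl
    rw [h1, Finset.sum_eq_single 0]
    · cases w with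
      | none =>
        by_cases h' : i = i₀ ∧ b = false
        · simp [Φ, packState, zeroHat, h', hH]
        · rw [Pi.single_eq_of_ne (by simpa using h')]
          simp [Φ, packState, h']
      | some a => simp [Φ, packState, zeroHat]
    · intro k' _ hk'
      rw [Pi.single_eq_of_ne (by simp [hk']), mul_zero]
    · simp
  have hstep : ∀ t, oracle x (ctrlSign t (oracle x (ctrlReflection i₀ V t (Φ t)))) = Φ (t + 1) := by
    intro t
    rw [ctrlReflection_packState, oracle_ctrlSign_oracle]
    congr 1
    ext1 k
    by_cases h : t < (k : ℕ)
    · rw [if_pos h, if_pos h, min_eq_right h.le, min_eq_right (Nat.succ_le_of_lt h), pow_succ']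
      rw [ContinuousLinearMap.map_smul, ContinuousLinearMap.map_smul]
      rfl
    · rw [if_neg h, if_neg h, min_eq_left (not_lt.1 h), min_eq_left (by omega)]
  -- The unitary after the second query is left open: it is the next reflection, or `star H` in the
  -- last round.
  have hsucc : ∀ t, t < M → Q.state x (2 * t) = ctrlReflection i₀ V t (Φ t) →
      Q.state x (2 * t + 2) =
        (Q.unitary (2 * t + 2) : Matrix (SimBasis n M N) (SimBasis n M N) ℂ).mulVec
          (Φ (t + 1)) := by
    intro t ht h
    have hu : Q.unitary (2 * t + 1) = Us t := by
      simp only [Q]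
      rw [if_neg (by omega), if_neg (by omega), if_neg (by omega)]
      congr 1
      omega
    rw [QueryAlgorithm.state, QueryAlgorithm.state, hu, h, ← hstep t, ← hUs]
  have hstate : ∀ t, t < M → Q.state x (2 * t) = ctrlReflection i₀ V t (Φ t) := by
    intro t
    induction t with
    | zero =>
      intro _
      have hu : Q.unitary 0 = Up := by
        simp only [Q]
        rw [if_neg (by omega), if_pos trivial]
      rw [mul_zero, QueryAlgorithm.state, hu, ← hΦ0]
      exact hUp _
    | succ t ih =>
      intro ht
      have hu : Q.unitary (2 * t + 2) = Ur (t + 1) := by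
        simp only [Q]
        rw [if_neg (by omega), if_neg (by omega), if_pos (by omega)]
        congr 1
        omega
      rw [mul_add, mul_one, hsucc t (by omega) (ih (by omega)), hu, hUr]
  have hfinal : Q.state x (2 * M) = phaseGate (star H : Matrix (Fin M) (Fin M) ℂ) (Φ M) := by
    obtain ⟨t, rfl⟩ : ∃ t, M = t + 1 := ⟨M - 1, by omega⟩
    have hu : Q.unitary (2 * t + 2) = Uf := by
      simp only [Q]
      rw [if_pos (by ring)]
    rw [mul_add, mul_one, hsucc t (by omega) (hstate t (by omega)), hu, hUf]
    rfl
  set z : AdvSpace n (Fin N) := (r : ℂ) • ∑ k : Fin M, (r : ℂ) • (U ^ (k : ℕ)) (zeroHat n (Fin N))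
    with hz
  have hamp : ∀ s : SliceBasis n N, Q.state x (2 * M) (s.1, s.2.1, (0, s.2.2)) =
      embedSlice i₀ z s := by
    intro s
    have h1 : phaseGate (star H : Matrix (Fin M) (Fin M) ℂ) (Φ M) (s.1, s.2.1, (0, s.2.2)) =
        ∑ k : Fin M, star ((H : Matrix (Fin M) (Fin M) ℂ) k 0) * Φ M (s.1, s.2.1, (k, s.2.2)) := rfl
    rw [hfinal, h1, hz, map_smul, map_sum, PiLp.smul_apply, WithLp.ofLp_sum, Finset.sum_apply,
      smul_eq_mul, Finset.mul_sum]
    refine Finset.sum_congr rfl fun k _ => ?_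
    rw [hH]
    simp only [Φ, packState, min_eq_left k.2.le, Complex.star_def, Complex.conj_ofReal]
  have hprob : Q.outputProb x true = ‖z‖ ^ 2 := by
    have h1 : Q.outputProb x true = ∑ s : SimBasis n M N,
        if s.2.2.1 = 0 then ‖Q.state x (2 * M) s‖ ^ 2 else 0 := by
      refine Finset.sum_congr rfl fun s _ => ?_
      simp [Q]
    rw [h1, sum_simBasis, Finset.sum_eq_single 0 (fun k _ hk => by simp [hk]) (by simp),
      ← (embedSlice i₀).norm_map z, EuclideanSpace.norm_sq_eq]
    refine Finset.sum_congr rfl fun s _ => ?_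
    rw [if_pos rfl, hamp]
  rw [hprob, phaseEstProb, hz, ← Finset.smul_sum, smul_smul,
    ← Fin.sum_univ_eq_sum_range (fun k => Complex.exp (-(2 * Real.pi * Complex.I * k * (0 : ℕ) / M)) •
      (U ^ k) (zeroHat n (Fin N))) M]
  congr 3
  · rw [hr, ← Complex.ofReal_mul, ← mul_inv, Real.mul_self_sqrt (Nat.cast_nonneg M)]
    simp
  · simp

end Simulation

/-! ### Bounds on the outcome of phase estimation -/

section PhaseEstimation

variable {E : Type*} [NormedAddCommGroup E] [InnerProductSpace ℂ E] {U : E →L[ℂ] E} {M : ℕ}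

lemma phaseEstProb_zero (M : ℕ) (U : E →L[ℂ] E) (z : E) :
    phaseEstProb M U z 0 = ‖(M : ℂ)⁻¹ • ∑ k ∈ Finset.range M, (U ^ k) z‖ ^ 2 := by
  simp [phaseEstProb]

/-- Every `U ^ k z` has the same inner product with the fixed vector `ψ`, hence so does their
average; then Cauchy–Schwarz. -/
lemma norm_inner_sq_le_phaseEstProb (hM : 0 < M)
    (hU : ∀ a b, inner ℂ (U a) (U b) = inner ℂ a b) {ψ : E} (hψ : U ψ = ψ) (z : E) :
    ‖inner ℂ ψ z‖ ^ 2 ≤ ‖ψ‖ ^ 2 * phaseEstProb M U z 0 := by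
  have hk : ∀ k : ℕ, inner ℂ ψ ((U ^ k) z) = inner ℂ ψ z := by
    intro k
    induction k with
    | zero => simp
    | succ k ih =>
      rw [pow_succ', mul_apply_eq_comp, ← ih]
      nth_rw 1 [← hψ]
      rw [hU]
  have h : inner ℂ ψ ((M : ℂ)⁻¹ • ∑ k ∈ Finset.range M, (U ^ k) z) = inner ℂ ψ z := by
    rw [inner_smul_right, inner_sum]
    simp only [hk, Finset.sum_const, Finset.card_range, nsmul_eq_mul]
    rw [← mul_assoc, inv_mul_cancel₀ (Nat.cast_ne_zero.2 hM.ne'), one_mul]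
  rw [phaseEstProb_zero, ← mul_pow, ← h]
  gcongr
  exact norm_inner_le_norm _ _

/-- Up to `e`, the vector `z` is a coboundary of `U`, so its orbit sum telescopes to `(φ - U ^ M φ)
/ 2`, of norm at most `‖φ‖`. -/
lemma phaseEstProb_le_of_sub_eq (hM : 0 < M) (hU : ∀ a, ‖U a‖ = ‖a‖) {φ z e : E}
    (h : φ - U φ = (2 : ℂ) • (z - e)) :
    phaseEstProb M U z 0 ≤ (‖φ‖ / M + ‖e‖) ^ 2 := by
  have hpow : ∀ (k : ℕ) a, ‖(U ^ k) a‖ = ‖a‖ := by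
    intro k
    induction k with
    | zero => simp
    | succ k ih => intro a; rw [pow_succ', mul_apply_eq_comp, hU, ih]
  have hM' : (0 : ℝ) < M := Nat.cast_pos.2 hM
  have htel : ∑ k ∈ Finset.range M, (U ^ k) (φ - U φ) = φ - (U ^ M) φ := by
    have := Finset.sum_range_sub' (fun k => (U ^ k) φ) M
    rw [pow_zero] at this
    refine (Finset.sum_congr rfl fun k _ => ?_).trans this
    rw [map_sub, pow_succ, mul_apply_eq_comp]
  have hsplit : ∑ k ∈ Finset.range M, (U ^ k) z =
      (2 : ℂ)⁻¹ • (φ - (U ^ M) φ) + ∑ k ∈ Finset.range M, (U ^ k) e := by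
    rw [← htel, h, Finset.smul_sum, ← Finset.sum_add_distrib]
    refine Finset.sum_congr rfl fun k _ => ?_
    rw [map_smul, smul_smul, inv_mul_cancel₀ two_ne_zero, one_smul, ← map_add, sub_add_cancel]
  rw [phaseEstProb_zero]
  gcongr
  rw [hsplit, norm_smul, norm_inv, Complex.norm_natCast]
  have h1 : ‖(2 : ℂ)⁻¹ • (φ - (U ^ M) φ)‖ ≤ ‖φ‖ := by
    rw [norm_smul, norm_inv, Complex.norm_ofNat]
    have := norm_sub_le φ ((U ^ M) φ)
    rw [hpow] at this
    linarith
  have h2 : ‖∑ k ∈ Finset.range M, (U ^ k) e‖ ≤ M * ‖e‖ := by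
    refine (norm_sum_le _ _).trans ?_
    simp only [hpow, Finset.sum_const, Finset.card_range, nsmul_eq_mul, le_refl]
  calc (M : ℝ)⁻¹ * ‖(2 : ℂ)⁻¹ • (φ - (U ^ M) φ) + ∑ k ∈ Finset.range M, (U ^ k) e‖
      ≤ (M : ℝ)⁻¹ * (‖φ‖ + M * ‖e‖) := by
        gcongr
        exact (norm_add_le _ _).trans (add_le_add h1 h2)
    _ = ‖φ‖ / M + ‖e‖ := by field_simp

end PhaseEstimation

/-! ### Products of two reflections and the effective spectral gap -/

section TwoReflections

variable {n : ℕ} {ι : Type} [Fintype ι] [DecidableEq ι] (x : Fin n → Bool)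
  (V : Submodule ℂ (AdvSpace n ι))

lemma norm_inputProj_le (φ : AdvSpace n ι) : ‖inputProj x φ‖ ≤ ‖φ‖ := by
  rw [EuclideanSpace.norm_eq, EuclideanSpace.norm_eq]
  refine Real.sqrt_le_sqrt (Finset.sum_le_sum fun s _ => ?_)
  rcases s with _ | ⟨i, k, b⟩
  · simp
  · rw [inputProj_some]
    split_ifs
    · rfl
    · simp

lemma norm_two_smul_inputProj_sub_one (φ : AdvSpace n ι) :
    ‖((2 : ℂ) • inputProj x - 1 : AdvSpace n ι →L[ℂ] AdvSpace n ι) φ‖ = ‖φ‖ := by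
  rw [EuclideanSpace.norm_eq, EuclideanSpace.norm_eq]
  congr 1
  refine Finset.sum_congr rfl fun s _ => ?_
  rcases s with _ | ⟨i, k, b⟩
  · simp [two_mul]
  · by_cases h : b = x i <;> simp [h, two_mul]

/-- The product of the two reflections. -/
def twoReflections : AdvSpace n ι →L[ℂ] AdvSpace n ι :=
  ((2 : ℂ) • inputProj x - 1) * ((2 : ℂ) • V.starProjection - 1)

lemma norm_twoReflections (φ : AdvSpace n ι) : ‖twoReflections x V φ‖ = ‖φ‖ := by
  rw [twoReflections, mul_apply_eq_comp, norm_two_smul_inputProj_sub_one,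
    ← V.reflection.norm_map φ, Submodule.reflection_apply]
  simp [two_smul]

lemma inner_twoReflections (φ φ' : AdvSpace n ι) :
    inner ℂ (twoReflections x V φ) (twoReflections x V φ') = inner ℂ φ φ' :=
  (LinearMap.norm_map_iff_inner_map_map (twoReflections x V)).1 (norm_twoReflections x V) φ φ'

lemma twoReflections_eq_self {φ : AdvSpace n ι} (hV : φ ∈ V) (hx : inputProj x φ = φ) :
    twoReflections x V φ = φ := by
  have h1 : V.starProjection φ = φ := Submodule.starProjection_eq_self_iff.2 hV
  simp [twoReflections, h1, hx, two_smul]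

lemma phaseEstProb_twoReflections_ge {M : ℕ} (hM : 0 < M) {ψ : AdvSpace n ι} (hV : ψ ∈ V)
    (hx : inputProj x ψ = ψ) (z : AdvSpace n ι) :
    ‖inner ℂ ψ z‖ ^ 2 ≤ ‖ψ‖ ^ 2 * phaseEstProb M (twoReflections x V) z 0 :=
  norm_inner_sq_le_phaseEstProb hM (inner_twoReflections x V) (twoReflections_eq_self x V hV hx) z

/-- The component `χ` of `φ` orthogonal to `V` satisfies `U χ = χ - 2 Π_x χ`, so `Π_x φ` is half a
coboundary plus the error `Π_x` applied to the projection of `φ` on `V`. -/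
lemma phaseEstProb_twoReflections_le {M : ℕ} (hM : 0 < M) (φ : AdvSpace n ι) :
    phaseEstProb M (twoReflections x V) (inputProj x φ) 0 ≤
      (‖φ‖ / M + ‖V.starProjection φ‖) ^ 2 := by
  set χ := φ - V.starProjection φ with hχ
  have h0 : V.starProjection χ = 0 := by
    rw [hχ, map_sub, sub_eq_zero]
    exact (Submodule.starProjection_eq_self_iff.2 (Submodule.starProjection_apply_mem V φ)).symm
  have h1 : χ - twoReflections x V χ =
      (2 : ℂ) • (inputProj x φ - inputProj x (V.starProjection φ)) := by
    rw [← map_sub, ← hχ]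
    simp [twoReflections, h0, two_smul]
  refine (phaseEstProb_le_of_sub_eq hM (norm_twoReflections x V) h1).trans ?_
  have h2 : ‖χ‖ ≤ ‖φ‖ := by
    have := Submodule.norm_sq_eq_add_norm_sq_starProjection φ V
    rw [Submodule.starProjection_orthogonal'] at this
    have h3 : ‖χ‖ ^ 2 ≤ ‖φ‖ ^ 2 := by
      rw [this, hχ]
      simp
    exact (pow_le_pow_iff_left₀ (norm_nonneg _) (norm_nonneg _) two_ne_zero).1 h3
  have h3 := norm_inputProj_le x (V.starProjection φ)
  gcongr

end TwoReflections

/-! ### Gaussian matrices -/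

section Gaussian

/-- Proved by comparing characteristic functions, which multiply over independent entries. -/
lemma map_pi_gaussianReal_linear {ι : Type} [Fintype ι] (w : ℝ≥0) (u : ι → ℝ) :
    (Measure.pi fun _ : ι => gaussianReal 0 w).map (fun s => ∑ k, s k * u k) =
      gaussianReal 0 (w * (∑ k, u k ^ 2).toNNReal) := by
  have hm : Measurable fun s : ι → ℝ => ∑ k, s k * u k := by fun_prop
  have : IsProbabilityMeasure
      ((Measure.pi fun _ : ι => gaussianReal 0 w).map (fun s => ∑ k, s k * u k)) :=
    Measure.isProbabilityMeasure_map hm.aemeasurable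
  refine Measure.ext_of_charFun (funext fun t => ?_)
  rw [charFun_gaussianReal, charFun_apply_real, integral_map hm.aemeasurable (by fun_prop)]
  have h1 : ∀ s : ι → ℝ, Complex.exp (t * ((∑ k, s k * u k : ℝ) : ℂ) * Complex.I) =
      ∏ k, Complex.exp (((t * u k : ℝ) : ℂ) * (s k : ℂ) * Complex.I) := fun s => by
    rw [← Complex.exp_sum]
    congr 1
    push_cast
    rw [Finset.mul_sum, Finset.sum_mul]
    exact Finset.sum_congr rfl fun k _ => by ring
  simp_rw [h1]
  rw [integral_fintype_prod_eq_prod (𝕜 := ℂ)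
    (fun k (y : ℝ) => Complex.exp (((t * u k : ℝ) : ℂ) * (y : ℂ) * Complex.I))]
  simp_rw [← charFun_apply_real, charFun_gaussianReal]
  rw [← Complex.exp_sum]
  congr 1
  have h2 : ((∑ k, u k ^ 2).toNNReal : ℝ) = ∑ k, u k ^ 2 :=
    Real.coe_toNNReal _ (Finset.sum_nonneg fun k _ => sq_nonneg _)
  have h3 : (((w * (∑ k, u k ^ 2).toNNReal : ℝ≥0) : ℝ) : ℂ) = w * ∑ k, (u k : ℂ) ^ 2 := by
    rw [NNReal.coe_mul, h2]
    push_cast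
    rfl
  rw [h3]
  simp only [Complex.ofReal_zero, mul_zero, zero_mul, zero_sub, Complex.ofReal_mul]
  rw [Finset.sum_neg_distrib, Finset.mul_sum, Finset.sum_mul, Finset.sum_div]
  congr 1
  refine Finset.sum_congr rfl fun k _ => ?_
  ring

lemma integral_exp_mul_sq_gaussianReal {v : ℝ≥0} (hv : v ≠ 0) {t : ℝ} (ht : 2 * t * v < 1) :
    ∫ y, Real.exp (t * y ^ 2) ∂(gaussianReal 0 v) = (√(1 - 2 * t * v))⁻¹ := by
  have hv' : (0 : ℝ) < v := by positivity
  rw [integral_gaussianReal_eq_integral_smul hv]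
  have h : ∀ y : ℝ, gaussianPDFReal 0 v y • Real.exp (t * y ^ 2) =
      (√(2 * Real.pi * v))⁻¹ * Real.exp (-((1 - 2 * t * v) / (2 * v)) * y ^ 2) := by
    intro y
    rw [gaussianPDFReal, smul_eq_mul, mul_assoc, ← Real.exp_add]
    congr 2
    field_simp
    ring
  simp_rw [h]
  rw [integral_const_mul, integral_gaussian, ← Real.sqrt_inv, ← Real.sqrt_inv,
    ← Real.sqrt_mul (by positivity)]
  congr 1
  have : (1 - 2 * t * v) ≠ 0 := by linarith
  field_simp

lemma inv_sqrt_one_sub_le {y : ℝ} (hy : |y| ≤ 1 / 2) :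
    (√(1 - y))⁻¹ ≤ Real.exp (y / 2 + y ^ 2) := by
  have hy1 : |y| < 1 := by linarith
  have hpos : 0 < 1 - y := by have := le_abs_self y; linarith
  have h := Real.abs_log_sub_add_sum_range_le hy1 1
  simp only [Finset.sum_range_one, zero_add, pow_one, Nat.cast_zero, div_one] at h
  have h2 : |y| ^ (1 + 1) / (1 - |y|) ≤ 2 * y ^ 2 := by
    rw [div_le_iff₀ (by linarith), ← sq_abs y, show 1 + 1 = 2 from rfl]
    nlinarith [mul_nonneg (sq_nonneg |y|) (by linarith : 0 ≤ 1 - 2 * |y|)]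
  have h3 := neg_abs_le (y + Real.log (1 - y))
  rw [← Real.exp_log hpos, Real.sqrt_eq_rpow, ← Real.exp_mul, ← Real.exp_neg]
  apply Real.exp_le_exp.2
  linarith

end Gaussian

/-! ### Chernoff bounds for the Johnson–Lindenstrauss matrix -/

section JohnsonLindenstrauss

variable {N : ℕ} {ι : Type} [Fintype ι]

instance : IsProbabilityMeasure (jlMeasure N ι) := by
  unfold jlMeasure; infer_instance

/-- The squared norm of `S u`. -/
def jlNormSq (S : Fin N → ι → ℝ) (u : ι → ℝ) : ℝ := ∑ a, (∑ k, S a k * u k) ^ 2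

lemma integral_exp_jlNormSq (hN : 0 < N) {u : ι → ℝ} (hu : 0 < ∑ k, u k ^ 2) {t : ℝ}
    (ht : 2 * t * ((∑ k, u k ^ 2) / N) < 1) :
    Integrable (fun S => Real.exp (t * jlNormSq S u)) (jlMeasure N ι) ∧
    mgf (fun S => jlNormSq S u) (jlMeasure N ι) t =
      (√(1 - 2 * t * ((∑ k, u k ^ 2) / N)))⁻¹ ^ N := by
  set σ : ℝ≥0 := (∑ k, u k ^ 2).toNNReal with hσ
  have hσ' : (σ : ℝ) = ∑ k, u k ^ 2 := Real.coe_toNNReal _ hu.le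
  set v : ℝ≥0 := (N : ℝ≥0)⁻¹ * σ with hv
  have hv' : (v : ℝ) = (∑ k, u k ^ 2) / N := by
    rw [hv, NNReal.coe_mul, hσ', NNReal.coe_inv, NNReal.coe_natCast]
    field_simp
  have hv0 : v ≠ 0 := by
    have : (0 : ℝ) < v := by
      rw [hv']
      have : (0 : ℝ) < N := Nat.cast_pos.2 hN
      positivity
    exact_mod_cast this.ne'
  have hrow : ∫ s : ι → ℝ, Real.exp (t * (∑ k, s k * u k) ^ 2)
      ∂(Measure.pi fun _ : ι => gaussianReal 0 (N : ℝ≥0)⁻¹) =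
      (√(1 - 2 * t * ((∑ k, u k ^ 2) / N)))⁻¹ := by
    rw [← hv', ← integral_exp_mul_sq_gaussianReal hv0 (by rwa [hv']), hv, hσ,
      ← map_pi_gaussianReal_linear, integral_map
        (Measurable.aemeasurable (by fun_prop)) (by fun_prop)]
  have hint : ∫ S, Real.exp (t * jlNormSq S u) ∂(jlMeasure N ι) =
      (√(1 - 2 * t * ((∑ k, u k ^ 2) / N)))⁻¹ ^ N := by
    have h1 : ∀ S : Fin N → ι → ℝ, Real.exp (t * jlNormSq S u) =
        ∏ a, Real.exp (t * (∑ k, S a k * u k) ^ 2) := fun S => by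
      rw [← Real.exp_sum, jlNormSq, Finset.mul_sum]
    simp_rw [h1]
    rw [jlMeasure, integral_fintype_prod_eq_pow (𝕜 := ℝ)
      (fun s : ι → ℝ => Real.exp (t * (∑ k, s k * u k) ^ 2)), hrow, Fintype.card_fin]
  refine ⟨?_, hint⟩
  -- The Bochner integral of a non-integrable function is `0`, but the computed value is positive.
  by_contra h
  rw [integral_undef h] at hint
  have : 0 < √(1 - 2 * t * ((∑ k, u k ^ 2) / N)) := Real.sqrt_pos.2 (by linarith)
  exact absurd hint (by positivity)

lemma mgf_jlNormSq_le (hN : 0 < N) {u : ι → ℝ} (hu : 0 < ∑ k, u k ^ 2) {y : ℝ}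
    (hy : |y| ≤ 1 / 2) :
    Integrable (fun S => Real.exp (y * N / (2 * ∑ k, u k ^ 2) * jlNormSq S u)) (jlMeasure N ι) ∧
    mgf (fun S => jlNormSq S u) (jlMeasure N ι) (y * N / (2 * ∑ k, u k ^ 2)) ≤
      Real.exp (N * (y / 2 + y ^ 2)) := by
  have hN' : (0 : ℝ) < N := Nat.cast_pos.2 hN
  have h : 2 * (y * N / (2 * ∑ k, u k ^ 2)) * ((∑ k, u k ^ 2) / N) = y := by field_simp
  obtain ⟨h1, h2⟩ := integral_exp_jlNormSq hN hu (t := y * N / (2 * ∑ k, u k ^ 2)) (by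
    rw [h]; linarith [le_abs_self y])
  refine ⟨h1, ?_⟩
  rw [h2, h, Real.exp_nat_mul]
  gcongr
  exact inv_sqrt_one_sub_le hy

/-- Chernoff's bound with `y = ±ε / 4`: in both tails the exponent is `-N ε² / 8 + N ε² / 16`. -/
lemma jlNormSq_tail (hN : 0 < N) {ε : ℝ} (hε : 0 < ε) (hε1 : ε ≤ 1) (u : ι → ℝ) :
    (jlMeasure N ι).real {S | ε * ∑ k, u k ^ 2 < |jlNormSq S u - ∑ k, u k ^ 2|} ≤
      2 * Real.exp (-(N * ε ^ 2 / 16)) := by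
  set σ : ℝ := ∑ k, u k ^ 2 with hσ
  rcases (Finset.sum_nonneg fun k _ => sq_nonneg (u k) : 0 ≤ σ).eq_or_lt with h0 | hpos
  · have hu : ∀ k, u k = 0 := fun k => by
      have := (Finset.sum_eq_zero_iff_of_nonneg fun k _ => sq_nonneg (u k)).1 h0.symm k
        (Finset.mem_univ k)
      simpa using this
    have : {S : Fin N → ι → ℝ | ε * σ < |jlNormSq S u - σ|} = ∅ := by
      rw [hσ.trans h0.symm]
      ext S
      simp [jlNormSq, hu]
    rw [this]
    simp
    positivity
  have hN' : (0 : ℝ) < N := Nat.cast_pos.2 hN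
  obtain ⟨i1, m1⟩ := mgf_jlNormSq_le hN hpos (y := ε / 4)
    (by rw [abs_of_pos (by positivity)]; linarith)
  obtain ⟨i2, m2⟩ := mgf_jlNormSq_le hN hpos (y := -(ε / 4))
    (by rw [abs_neg, abs_of_pos (by positivity)]; linarith)
  have c1 := measure_ge_le_exp_mul_mgf (μ := jlMeasure N ι) (X := fun S => jlNormSq S u)
    ((1 + ε) * σ) (by positivity) i1
  have c2 := measure_le_le_exp_mul_mgf (μ := jlMeasure N ι) (X := fun S => jlNormSq S u)
    ((1 - ε) * σ) (by rw [neg_mul, neg_div, neg_nonpos]; positivity) i2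
  have b1 : (jlMeasure N ι).real {S | (1 + ε) * σ ≤ jlNormSq S u} ≤
      Real.exp (-(N * ε ^ 2 / 16)) := by
    refine c1.trans ((mul_le_mul_of_nonneg_left m1 (Real.exp_nonneg _)).trans ?_)
    rw [← Real.exp_add]
    apply le_of_eq
    congr 1
    field_simp
    ring
  have b2 : (jlMeasure N ι).real {S | jlNormSq S u ≤ (1 - ε) * σ} ≤
      Real.exp (-(N * ε ^ 2 / 16)) := by
    refine c2.trans ((mul_le_mul_of_nonneg_left m2 (Real.exp_nonneg _)).trans ?_)
    rw [← Real.exp_add]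
    apply le_of_eq
    congr 1
    field_simp
    ring
  have hsub : {S : Fin N → ι → ℝ | ε * σ < |jlNormSq S u - σ|} ⊆
      {S | (1 + ε) * σ ≤ jlNormSq S u} ∪ {S | jlNormSq S u ≤ (1 - ε) * σ} := by
    intro S hS
    rw [Set.mem_ofPred_eq, lt_abs] at hS
    rw [Set.mem_union, Set.mem_ofPred_eq, Set.mem_ofPred_eq]
    rcases hS with h | h
    · left; linarith
    · right; linarith
  calc _ ≤ _ := measureReal_mono hsub
    _ ≤ _ := measureReal_union_le _ _
    _ ≤ _ := by linarith

/-- The defect of `S` on the inner product of two real vectors. -/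
def jlErr (S : Fin N → ι → ℝ) (p q : ι → ℝ) : ℝ :=
  ∑ a, (∑ k, S a k * p k) * (∑ k, S a k * q k) - ∑ k, p k * q k

lemma jlErr_polarization (S : Fin N → ι → ℝ) (p q : ι → ℝ) :
    4 * jlErr S p q = (jlNormSq S (p + q) - ∑ k, (p + q) k ^ 2) -
      (jlNormSq S (p - q) - ∑ k, (p - q) k ^ 2) := by
  simp only [jlErr, jlNormSq, Pi.add_apply, Pi.sub_apply, mul_add, mul_sub (S _ _),
    Finset.sum_add_distrib, Finset.sum_sub_distrib]
  rw [sub_sub_sub_comm, ← Finset.sum_sub_distrib, ← Finset.sum_sub_distrib, mul_sub,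
    Finset.mul_sum, Finset.mul_sum]
  congr 1 <;> exact Finset.sum_congr rfl fun k _ => by ring

lemma jlErr_smul (S : Fin N → ι → ℝ) (c d : ℝ) (p q : ι → ℝ) :
    jlErr S (c • p) (d • q) = c * d * jlErr S p q := by
  simp only [jlErr, Pi.smul_apply, smul_eq_mul, mul_left_comm (S _ _), ← Finset.mul_sum]
  rw [mul_sub, Finset.mul_sum, Finset.mul_sum]
  congr 1 <;> exact Finset.sum_congr rfl fun k _ => by ring

/-- Polarization applied to `‖q‖ p` and `‖p‖ q`. These have equal norms, so the parallelogram law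
turns the two norm errors into a bound relative to `‖p‖ ‖q‖`. -/
lemma jlErr_tail (hN : 0 < N) {ε : ℝ} (hε : 0 < ε) (hε1 : ε ≤ 1) (p q : ι → ℝ) :
    (jlMeasure N ι).real {S | ε * (√(∑ k, p k ^ 2) * √(∑ k, q k ^ 2)) < |jlErr S p q|} ≤
      4 * Real.exp (-(N * ε ^ 2 / 16)) := by
  set a := √(∑ k, p k ^ 2) with ha
  set b := √(∑ k, q k ^ 2) with hb
  have ha2 : a ^ 2 = ∑ k, p k ^ 2 := Real.sq_sqrt (Finset.sum_nonneg fun k _ => sq_nonneg _)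
  have hb2 : b ^ 2 = ∑ k, q k ^ 2 := Real.sq_sqrt (Finset.sum_nonneg fun k _ => sq_nonneg _)
  have ha0 : 0 ≤ a := Real.sqrt_nonneg _
  have hb0 : 0 ≤ b := Real.sqrt_nonneg _
  have t1 := jlNormSq_tail hN hε hε1 (b • p + a • q)
  have t2 := jlNormSq_tail hN hε hε1 (b • p - a • q)
  have hsub : {S : Fin N → ι → ℝ | ε * (a * b) < |jlErr S p q|} ⊆
      {S | ε * ∑ k, (b • p + a • q) k ^ 2 <
        |jlNormSq S (b • p + a • q) - ∑ k, (b • p + a • q) k ^ 2|} ∪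
      {S | ε * ∑ k, (b • p - a • q) k ^ 2 <
        |jlNormSq S (b • p - a • q) - ∑ k, (b • p - a • q) k ^ 2|} := by
    intro S hS
    by_contra hn
    rw [Set.mem_union, not_or] at hn
    obtain ⟨h1, h2⟩ := hn
    rw [Set.mem_ofPred_eq, not_lt] at h1 h2
    rw [Set.mem_ofPred_eq] at hS
    have hsum : ∑ k, (b • p + a • q) k ^ 2 + ∑ k, (b • p - a • q) k ^ 2 = 4 * (a * b) ^ 2 := by
      have : ∑ k, (b • p + a • q) k ^ 2 + ∑ k, (b • p - a • q) k ^ 2 =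
          2 * (b ^ 2 * ∑ k, p k ^ 2 + a ^ 2 * ∑ k, q k ^ 2) := by
        rw [← Finset.sum_add_distrib, Finset.mul_sum, Finset.mul_sum, ← Finset.sum_add_distrib,
          Finset.mul_sum]
        refine Finset.sum_congr rfl fun k _ => ?_
        simp only [Pi.add_apply, Pi.sub_apply, Pi.smul_apply, smul_eq_mul]
        ring
      rw [this, ← ha2, ← hb2]
      ring
    have hpol := jlErr_polarization S (b • p) (a • q)
    rw [jlErr_smul] at hpol
    have hE : |4 * (b * a * jlErr S p q)| ≤ ε * (4 * (a * b) ^ 2) := by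
      rw [hpol, ← hsum, mul_add]
      exact (abs_sub _ _).trans (add_le_add h1 h2)
    have hab : 0 ≤ a * b := mul_nonneg ha0 hb0
    rw [abs_mul, abs_mul, abs_mul, abs_of_nonneg hb0, abs_of_nonneg ha0, abs_of_pos four_pos] at hE
    rcases hab.eq_or_lt with h0 | hpos
    · have : p = 0 ∨ q = 0 := by
        rcases mul_eq_zero.1 h0.symm with h | h
        · left
          rw [h, zero_pow two_ne_zero] at ha2
          ext k
          simpa using (Finset.sum_eq_zero_iff_of_nonneg fun k _ => sq_nonneg (p k)).1 ha2.symm k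
            (Finset.mem_univ k)
        · right
          rw [h, zero_pow two_ne_zero] at hb2
          ext k
          simpa using (Finset.sum_eq_zero_iff_of_nonneg fun k _ => sq_nonneg (q k)).1 hb2.symm k
            (Finset.mem_univ k)
      have hz : jlErr S p q = 0 := by
        rcases this with h | h <;> simp [jlErr, h]
      rw [hz, ← h0] at hS
      simp at hS
    · nlinarith [mul_lt_mul_of_pos_left hS hpos]
  calc _ ≤ _ := measureReal_mono hsub
    _ ≤ _ := measureReal_union_le _ _
    _ ≤ _ := by linarith

end JohnsonLindenstrauss

/-! ### Compression approximately preserves inner products -/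

section Compression

variable {n N : ℕ} {ι : Type} [Fintype ι]

/-- The compression as a linear map. -/
def compressLinear (S : Fin N → ι → ℝ) : AdvSpace n ι →ₗ[ℂ] AdvSpace n (Fin N) where
  toFun := compress S
  map_add' φ φ' := by
    ext s
    rcases s with _ | ⟨i, a, b⟩
    · simp [compress]
    · simp [compress, mul_add, Finset.sum_add_distrib]
  map_smul' c φ := by
    ext s
    rcases s with _ | ⟨i, a, b⟩
    · simp [compress]
    · simp [compress, Finset.mul_sum, mul_left_comm]

@[simp] lemma compress_none (S : Fin N → ι → ℝ) (φ : AdvSpace n ι) :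
    compress S φ none = φ none := rfl

@[simp] lemma compress_some (S : Fin N → ι → ℝ) (φ : AdvSpace n ι) (i : Fin n) (a : Fin N)
    (b : Bool) : compress S φ (some (i, a, b)) = ∑ k, (S a k : ℂ) * φ (some (i, k, b)) := rfl

lemma jlErr_comm (S : Fin N → ι → ℝ) (p q : ι → ℝ) : jlErr S p q = jlErr S q p := by
  simp only [jlErr, mul_comm]

/-- The real or imaginary part of the vector in the inner register, in the block `|i⟩|b⟩`. -/
def blockPart (φ : AdvSpace n ι) (i : Fin n) (b : Bool) (im : Bool) : ι → ℝ :=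
  fun k => if im then (φ (some (i, k, b))).im else (φ (some (i, k, b))).re

/-- The norm of the vector in the block `|i⟩|b⟩`. -/
def blockNorm (φ : AdvSpace n ι) (i : Fin n) (b : Bool) : ℝ :=
  √(∑ k, ‖φ (some (i, k, b))‖ ^ 2)

lemma sqrt_blockPart_le (φ : AdvSpace n ι) (i : Fin n) (b im : Bool) :
    √(∑ k, blockPart φ i b im k ^ 2) ≤ blockNorm φ i b := by
  refine Real.sqrt_le_sqrt (Finset.sum_le_sum fun k _ => ?_)
  rw [← sq_abs]
  unfold blockPart
  gcongr
  split_ifs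
  · exact Complex.abs_im_le_norm _
  · exact Complex.abs_re_le_norm _

lemma sum_advSpace {β : Type*} [AddCommMonoid β] (F : Option (Fin n × ι × Bool) → β) :
    ∑ s, F s = F none + ∑ p : Fin n × Bool, ∑ k, F (some (p.1, k, p.2)) := by
  rw [Fintype.sum_option]
  simp only [Fintype.sum_prod_type]
  congr 1
  exact Finset.sum_congr rfl fun i _ => Finset.sum_comm

lemma sum_blockNorm_sq_le (φ : AdvSpace n ι) :
    ∑ p : Fin n × Bool, blockNorm φ p.1 p.2 ^ 2 ≤ ‖φ‖ ^ 2 := by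
  rw [EuclideanSpace.norm_sq_eq, sum_advSpace]
  simp only [blockNorm, Real.sq_sqrt (Finset.sum_nonneg fun _ _ => sq_nonneg _)]
  exact le_add_of_nonneg_left (sq_nonneg _)

lemma sum_blockNorm_mul_le (φ φ' : AdvSpace n ι) :
    ∑ p : Fin n × Bool, blockNorm φ p.1 p.2 * blockNorm φ' p.1 p.2 ≤ ‖φ‖ * ‖φ'‖ := by
  refine (Real.sum_mul_le_sqrt_mul_sqrt _ _ _).trans ?_
  gcongr
  · exact Real.sqrt_le_iff.2 ⟨norm_nonneg _, sum_blockNorm_sq_le φ⟩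
  · exact Real.sqrt_le_iff.2 ⟨norm_nonneg _, sum_blockNorm_sq_le φ'⟩

/-- As `S` is real and acts blockwise, real and imaginary parts are compressed separately and the
`|0̂⟩` terms cancel. -/
lemma inner_compress_sub_inner (S : Fin N → ι → ℝ) (φ φ' : AdvSpace n ι) :
    inner ℂ (compress S φ) (compress S φ') - inner ℂ φ φ' = ∑ p : Fin n × Bool,
      (((jlErr S (blockPart φ p.1 p.2 false) (blockPart φ' p.1 p.2 false) : ℝ) : ℂ) +
        ((jlErr S (blockPart φ p.1 p.2 true) (blockPart φ' p.1 p.2 true) : ℝ) : ℂ) +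
        (((jlErr S (blockPart φ p.1 p.2 false) (blockPart φ' p.1 p.2 true) : ℝ) : ℂ) -
        ((jlErr S (blockPart φ p.1 p.2 true) (blockPart φ' p.1 p.2 false) : ℝ) : ℂ)) *
          Complex.I) := by
  rw [PiLp.inner_apply, PiLp.inner_apply, sum_advSpace, sum_advSpace, compress_none, compress_none,
    add_sub_add_left_eq_sub, ← Finset.sum_sub_distrib]
  refine Finset.sum_congr rfl fun p _ => ?_
  simp only [jlErr_comm S (blockPart φ _ _ _)]
  apply Complex.ext
  · simp [jlErr, blockPart, Finset.sum_add_distrib]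
    ring
  · simp [jlErr, blockPart, Finset.sum_add_distrib]
    ring

lemma norm_inner_compress_sub_inner_le {S : Fin N → ι → ℝ} {ε : ℝ} (hε : 0 ≤ ε)
    {φ φ' : AdvSpace n ι}
    (h : ∀ i b c c', |jlErr S (blockPart φ i b c) (blockPart φ' i b c')| ≤
      ε * (√(∑ k, blockPart φ i b c k ^ 2) * √(∑ k, blockPart φ' i b c' k ^ 2))) :
    ‖inner ℂ (compress S φ) (compress S φ') - inner ℂ φ φ'‖ ≤ 4 * ε * (‖φ‖ * ‖φ'‖) := by
  have h' : ∀ i b c c', ‖((jlErr S (blockPart φ i b c) (blockPart φ' i b c') : ℝ) : ℂ)‖ ≤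
      ε * (blockNorm φ i b * blockNorm φ' i b) := fun i b c c' => by
    rw [Complex.norm_real, Real.norm_eq_abs]
    refine (h i b c c').trans ?_
    have h1 := sqrt_blockPart_le φ i b c
    have h2 := sqrt_blockPart_le φ' i b c'
    gcongr
    exact (Real.sqrt_nonneg _).trans h1
  rw [inner_compress_sub_inner]
  calc _ ≤ ∑ p : Fin n × Bool, 4 * ε * (blockNorm φ p.1 p.2 * blockNorm φ' p.1 p.2) := by
        refine (norm_sum_le _ _).trans (Finset.sum_le_sum fun p _ => ?_)
        have h1 := h' p.1 p.2 false false
        have h2 := h' p.1 p.2 true true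
        have h3 := h' p.1 p.2 false true
        have h4 := h' p.1 p.2 true false
        refine (norm_add_le _ _).trans ?_
        rw [norm_mul, Complex.norm_I, mul_one]
        have h5 := norm_add_le
          ((jlErr S (blockPart φ p.1 p.2 false) (blockPart φ' p.1 p.2 false) : ℝ) : ℂ)
          ((jlErr S (blockPart φ p.1 p.2 true) (blockPart φ' p.1 p.2 true) : ℝ) : ℂ)
        have h6 := norm_sub_le
          ((jlErr S (blockPart φ p.1 p.2 false) (blockPart φ' p.1 p.2 true) : ℝ) : ℂ)
          ((jlErr S (blockPart φ p.1 p.2 true) (blockPart φ' p.1 p.2 false) : ℝ) : ℂ)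
        linarith
    _ ≤ _ := by
        rw [← Finset.mul_sum]
        exact mul_le_mul_of_nonneg_left (sum_blockNorm_mul_le φ φ') (by positivity)

/-- `S` preserves the inner products of the family `z` up to the relative error `δ`. -/
def PreservesInner {J : Type} (δ : ℝ) (z : J → AdvSpace n ι) (S : Fin N → ι → ℝ) : Prop :=
  ∀ j j', ‖inner ℂ (compress S (z j)) (compress S (z j')) - inner ℂ (z j) (z j')‖ ≤
    δ * (‖z j‖ * ‖z j'‖)

/-- Union bound over pairs of vectors, the `2 n` blocks and four choices of real and imaginary
parts, each failing with probability at most `4 exp (-N ε² / 16)`. -/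
theorem jlMeasure_not_preservesInner_le {J : Type} [Fintype J] (hN : 0 < N) {ε : ℝ} (hε : 0 < ε)
    (hε1 : ε ≤ 1) (z : J → AdvSpace n ι) :
    (jlMeasure N ι).real {S | ¬ PreservesInner (4 * ε) z S} ≤
      32 * (n * (Fintype.card J) ^ 2) * Real.exp (-(N * ε ^ 2 / 16)) := by
  have hsub : {S : Fin N → ι → ℝ | ¬ PreservesInner (4 * ε) z S} ⊆
      ⋃ t : (J × J) × (Fin n × Bool) × (Bool × Bool),
      {S | ε * (√(∑ k, blockPart (z t.1.1) t.2.1.1 t.2.1.2 t.2.2.1 k ^ 2) *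
          √(∑ k, blockPart (z t.1.2) t.2.1.1 t.2.1.2 t.2.2.2 k ^ 2)) <
        |jlErr S (blockPart (z t.1.1) t.2.1.1 t.2.1.2 t.2.2.1)
          (blockPart (z t.1.2) t.2.1.1 t.2.1.2 t.2.2.2)|} := by
    intro S hS
    by_contra hn
    rw [Set.mem_ofPred_eq] at hS
    refine hS fun j j' => norm_inner_compress_sub_inner_le hε.le fun i b c c' => ?_
    by_contra hlt
    exact hn (Set.mem_iUnion.2 ⟨((j, j'), (i, b), (c, c')), by
      rw [Set.mem_ofPred_eq]; exact not_le.1 hlt⟩)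
  calc _ ≤ _ := measureReal_mono hsub
    _ ≤ _ := measureReal_iUnion_fintype_le _
    _ ≤ ∑ _t : (J × J) × (Fin n × Bool) × (Bool × Bool),
        4 * Real.exp (-(N * ε ^ 2 / 16)) :=
      Finset.sum_le_sum fun t _ => jlErr_tail hN hε hε1 _ _
    _ = _ := by
      simp
      ring

end Compression

/-! ### Projections onto the image of an approximate isometry -/

section ApproximateIsometry

variable {E F : Type*} [NormedAddCommGroup E] [InnerProductSpace ℂ E]
  [NormedAddCommGroup F] [InnerProductSpace ℂ F] [FiniteDimensional ℂ F]

lemma sum_norm_sq_le_card_mul {d : ℕ} (c : Fin d → ℂ) :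
    (∑ l, ‖c l‖) ^ 2 ≤ d * ∑ l, ‖c l‖ ^ 2 := by
  simpa using sq_sum_le_card_mul_sum_sq (s := Finset.univ) (f := fun l => ‖c l‖)

/-- Write the projection as `g = T h` with coordinates `c` of `h`. The Gram error is at most `δ (∑
|c_l|)² ≤ δ d ‖h‖²`, so `‖h‖² ≤ 2 ‖g‖²`. Also `‖g‖² = ⟨g, w⟩ ≤ η ∑ |c_l|`, and combining the two
bounds gives the claim. -/
lemma norm_sq_starProjection_map_le {d : ℕ} {V : Submodule ℂ E}
    (e : OrthonormalBasis (Fin d) ℂ V) (T : E →ₗ[ℂ] F) {δ η : ℝ} (hδ : δ * d ≤ 1 / 2)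
    (he : ∀ l l', ‖inner ℂ (T (e l)) (T (e l')) - inner ℂ (e l : E) (e l' : E)‖ ≤ δ)
    (w : F) (hw : ∀ l, ‖inner ℂ (T (e l)) w‖ ≤ η) :
    ‖(V.map T).starProjection w‖ ^ 2 ≤ 2 * d * η ^ 2 := by
  set g := (V.map T).starProjection w with hg
  obtain ⟨h, hV, hh⟩ := Submodule.mem_map.1 (Submodule.starProjection_apply_mem (V.map T) w)
  set c : Fin d → ℂ := fun l => e.repr ⟨h, hV⟩ l with hc
  have hsum : h = ∑ l, c l • (e l : E) := by
    have := congrArg Subtype.val (e.sum_repr ⟨h, hV⟩)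
    simpa using this.symm
  have hnorm : ‖h‖ ^ 2 = ∑ l, ‖c l‖ ^ 2 := by
    have h1 : ‖h‖ = ‖e.repr ⟨h, hV⟩‖ := by rw [e.repr.norm_map]; rfl
    rw [h1, EuclideanSpace.norm_sq_eq]
  have hT : T h = ∑ l, c l • T (e l) := by
    conv_lhs => rw [hsum]
    simp
  rw [← hg] at hh
  have hcard := sum_norm_sq_le_card_mul c
  rw [← hnorm] at hcard
  have hdiff : ‖inner ℂ (T h) (T h) - inner ℂ h h‖ ≤ δ * (∑ l, ‖c l‖) ^ 2 := by
    have h1 : inner ℂ (T h) (T h) - inner ℂ h h = ∑ l, ∑ l', (starRingEnd ℂ) (c l) * (c l' *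
        (inner ℂ (T (e l)) (T (e l')) - inner ℂ (e l : E) (e l' : E))) := by
      rw [hT]
      conv_lhs => rw [hsum]
      simp only [sum_inner, inner_sum, inner_smul_left, inner_smul_right, mul_sub,
        Finset.sum_sub_distrib, Finset.mul_sum]
      congr 1 <;>
      · rw [Finset.sum_comm]
        exact Finset.sum_congr rfl fun l _ => Finset.sum_congr rfl fun l' _ => by ring
    rw [h1, sq, Finset.sum_mul_sum, Finset.mul_sum]
    refine (norm_sum_le _ _).trans (Finset.sum_le_sum fun l _ => ?_)
    rw [Finset.mul_sum]
    refine (norm_sum_le _ _).trans (Finset.sum_le_sum fun l' _ => ?_)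
    rw [norm_mul, norm_mul, RCLike.norm_conj]
    calc _ ≤ ‖c l‖ * (‖c l'‖ * δ) := by gcongr; exact he l l'
      _ = _ := by ring
  have hlower : ‖h‖ ^ 2 ≤ 2 * ‖g‖ ^ 2 := by
    rw [inner_self_eq_norm_sq_to_K, inner_self_eq_norm_sq_to_K, hh] at hdiff
    have h2 : ‖((‖g‖ : ℂ) ^ 2 - (‖h‖ : ℂ) ^ 2)‖ = |‖g‖ ^ 2 - ‖h‖ ^ 2| := by
      rw [← Real.norm_eq_abs, ← Complex.norm_real]
      push_cast
      rfl
    have h3 : |‖g‖ ^ 2 - ‖h‖ ^ 2| ≤ δ * (∑ l, ‖c l‖) ^ 2 := h2 ▸ hdiff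
    -- The sign of `δ` is read off from a basis vector, so the empty basis is separate.
    by_cases hd0 : d = 0
    · subst hd0
      have : ‖h‖ ^ 2 = 0 := by rw [hnorm]; simp
      rw [this]; positivity
    have hδ0 : 0 ≤ δ := (norm_nonneg _).trans (he ⟨0, by omega⟩ ⟨0, by omega⟩)
    have h4 : δ * (∑ l, ‖c l‖) ^ 2 ≤ 1 / 2 * ‖h‖ ^ 2 := by
      calc _ ≤ δ * (d * ‖h‖ ^ 2) := by gcongr
        _ = δ * d * ‖h‖ ^ 2 := by ring
        _ ≤ _ := by gcongr
    have := neg_abs_le (‖g‖ ^ 2 - ‖h‖ ^ 2)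
    linarith
  have hself : ‖g‖ ^ 2 ≤ η * ∑ l, ‖c l‖ := by
    have h1 : inner ℂ g w = ((‖g‖ ^ 2 : ℝ) : ℂ) := by
      have h2 : inner ℂ g (w - g) = 0 := by
        rw [← inner_conj_symm, Submodule.starProjection_inner_eq_zero w g
          (Submodule.starProjection_apply_mem _ w), map_zero]
      rw [inner_sub_right, sub_eq_zero] at h2
      rw [h2, inner_self_eq_norm_sq_to_K]
      push_cast
      rfl
    have h2 : ‖g‖ ^ 2 = ‖inner ℂ g w‖ := by
      rw [h1, Complex.norm_real, Real.norm_of_nonneg (sq_nonneg _)]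
    rw [h2, ← hh, hT, sum_inner, Finset.mul_sum]
    refine (norm_sum_le _ _).trans (Finset.sum_le_sum fun l _ => ?_)
    rw [inner_smul_left, norm_mul, RCLike.norm_conj, mul_comm]
    gcongr
    exact hw l
  by_cases hg0 : ‖g‖ ^ 2 = 0
  · rw [hg0]; positivity
  have hgpos : 0 < ‖g‖ ^ 2 := lt_of_le_of_ne (sq_nonneg _) (Ne.symm hg0)
  have h1 : (‖g‖ ^ 2) ^ 2 ≤ η ^ 2 * (d * (2 * ‖g‖ ^ 2)) := by
    calc (‖g‖ ^ 2) ^ 2 ≤ (η * ∑ l, ‖c l‖) ^ 2 := by gcongr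
      _ = η ^ 2 * (∑ l, ‖c l‖) ^ 2 := by ring
      _ ≤ η ^ 2 * (d * (2 * ‖g‖ ^ 2)) := by
        gcongr
        exact hcard.trans (by gcongr)
  nlinarith

end ApproximateIsometry

/-! ### The two families of vectors -/

section Vectors

variable {n N : ℕ} {ι : Type} [Fintype ι]

lemma compress_inputProj [DecidableEq ι] (S : Fin N → ι → ℝ) (x : Fin n → Bool)
    (φ : AdvSpace n ι) : inputProj x (compress S φ) = compress S (inputProj x φ) := by
  ext s
  rcases s with _ | ⟨i, a, b⟩
  · simp
  · by_cases h : b = x i <;> simp [h]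

lemma compress_zeroHat [DecidableEq ι] (S : Fin N → ι → ℝ) :
    compress S (zeroHat n ι) = zeroHat n (Fin N) := by
  ext s
  rcases s with _ | ⟨i, a, b⟩ <;> simp [zeroHat]

variable {c A : ℝ} (y : Fin n → Bool) (u : Fin n → ι → ℝ)

@[simp] lemma psiVec_none : psiVec c A y u none =
    (((√(1 + (c * A)⁻¹ * ∑ i, ∑ k, u i k ^ 2))⁻¹ : ℝ) : ℂ) := rfl

@[simp] lemma psiVec_some (i : Fin n) (k : ι) (b : Bool) : psiVec c A y u (some (i, k, b)) =
    if b = y i then (((√(1 + (c * A)⁻¹ * ∑ i, ∑ k, u i k ^ 2))⁻¹ * (√(c * A))⁻¹ * u i k : ℝ) : ℂ)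
    else 0 := rfl

lemma inputProj_psiVec [DecidableEq ι] : inputProj y (psiVec c A y u) = psiVec c A y u := by
  ext s
  rcases s with _ | ⟨i, k, b⟩
  · simp
  · by_cases h : b = y i <;> simp [h]

lemma norm_psiVec (hcA : 0 < c * A) : ‖psiVec c A y u‖ = 1 := by
  set ν := 1 + (c * A)⁻¹ * ∑ i, ∑ k, u i k ^ 2 with hν
  have hpos : 0 < ν := by positivity
  have h : ‖psiVec c A y u‖ ^ 2 = 1 := by
    rw [EuclideanSpace.norm_sq_eq, Fintype.sum_option, psiVec_none, Complex.norm_real,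
      Real.norm_eq_abs, sq_abs]
    simp only [Fintype.sum_prod_type, psiVec_some, Fintype.sum_bool]
    have h1 : ∀ i k, ‖(if true = y i then (((√ν)⁻¹ * (√(c * A))⁻¹ * u i k : ℝ) : ℂ) else 0)‖ ^ 2 +
        ‖(if false = y i then (((√ν)⁻¹ * (√(c * A))⁻¹ * u i k : ℝ) : ℂ) else 0)‖ ^ 2 =
        ν⁻¹ * ((c * A)⁻¹ * u i k ^ 2) := by
      intro i k
      have h2 : ‖(((√ν)⁻¹ * (√(c * A))⁻¹ * u i k : ℝ) : ℂ)‖ ^ 2 =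
          ν⁻¹ * ((c * A)⁻¹ * u i k ^ 2) := by
        rw [Complex.norm_real, Real.norm_eq_abs, sq_abs, mul_pow, mul_pow, inv_pow, inv_pow,
          Real.sq_sqrt hpos.le, Real.sq_sqrt hcA.le, mul_assoc]
      cases y i
      · simp only [Bool.true_eq_false, if_false, if_true, norm_zero]
        rw [h2]; ring
      · simp only [Bool.false_eq_true, if_false, if_true, norm_zero]
        rw [h2]; ring
    simp only [← hν]
    simp only [h1, ← Finset.mul_sum]
    rw [inv_pow, Real.sq_sqrt hpos.le]
    nth_rw 1 [← mul_one ν⁻¹]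
    rw [← mul_add, ← hν, inv_mul_cancel₀ hpos.ne']
  exact (pow_eq_one_iff_of_nonneg (norm_nonneg _) two_ne_zero).1 h

/-- The unnormalized dual witness `|0̂⟩ - (c A)^{1/2} ∑_i |i⟩ |u_i⟩ |¬x_i⟩`. -/
def phiVec (c A : ℝ) (x : Fin n → Bool) (u : Fin n → ι → ℝ) : AdvSpace n ι :=
  WithLp.toLp 2 fun s => s.elim 1 fun p =>
    if p.2.2 = x p.1 then 0 else ((-(√(c * A) * u p.1 p.2.1) : ℝ) : ℂ)

omit [Fintype ι] in
@[simp] lemma phiVec_none : phiVec c A y u none = 1 := rfl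

omit [Fintype ι] in
@[simp] lemma phiVec_some (i : Fin n) (k : ι) (b : Bool) : phiVec c A y u (some (i, k, b)) =
    if b = y i then 0 else ((-(√(c * A) * u i k) : ℝ) : ℂ) := rfl

lemma inputProj_phiVec [DecidableEq ι] : inputProj y (phiVec c A y u) = zeroHat n ι := by
  ext s
  rcases s with _ | ⟨i, k, b⟩
  · simp [zeroHat]
  · by_cases h : b = y i <;> simp [h, zeroHat]

lemma norm_sq_phiVec (hcA : 0 < c * A) :
    ‖phiVec c A y u‖ ^ 2 = 1 + c * A * ∑ i, ∑ k, u i k ^ 2 := by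
  rw [EuclideanSpace.norm_sq_eq, Fintype.sum_option, phiVec_none, norm_one, one_pow]
  simp only [Fintype.sum_prod_type, phiVec_some, Fintype.sum_bool, Finset.mul_sum]
  congr 1
  refine Finset.sum_congr rfl fun i _ => Finset.sum_congr rfl fun k _ => ?_
  have h2 : ‖((-(√(c * A) * u i k) : ℝ) : ℂ)‖ ^ 2 = c * A * u i k ^ 2 := by
    rw [Complex.norm_real, Real.norm_eq_abs, sq_abs, neg_sq, mul_pow, Real.sq_sqrt hcA.le]
  cases y i
  · simp only [Bool.true_eq_false, if_false, if_true, norm_zero]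
    rw [h2]; ring
  · simp only [Bool.false_eq_true, if_false, if_true, norm_zero]
    rw [h2]; ring

/-- The supports meet only at `|0̂⟩` and where `y_i ≠ x_i`. There the factors `(c A)^{∓1/2}` cancel,
leaving `r - r · 1`. -/
lemma inner_psiVec_phiVec (hcA : 0 < c * A) (x : Fin n → Bool) (u' : Fin n → ι → ℝ)
    (h : ∑ i, (if y i ≠ x i then ∑ k, u i k * u' i k else 0) = 1) :
    inner ℂ (psiVec c A y u) (phiVec c A x u') = 0 := by
  rw [PiLp.inner_apply, Fintype.sum_option, psiVec_none, phiVec_none]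
  set r := (√(1 + (c * A)⁻¹ * ∑ i, ∑ k, u i k ^ 2))⁻¹ with hr
  have hs : (√(c * A)) ≠ 0 := (Real.sqrt_pos.2 hcA).ne'
  have h1 : ∀ i, ∑ k, ∑ b, inner ℂ (psiVec c A y u (some (i, k, b)))
      (phiVec c A x u' (some (i, k, b))) =
      ((-(r * (if y i ≠ x i then ∑ k, u i k * u' i k else 0)) : ℝ) : ℂ) := by
    intro i
    by_cases hi : y i = x i
    · rw [if_neg (not_not.2 hi), mul_zero, neg_zero, Complex.ofReal_zero]
      refine Finset.sum_eq_zero fun k _ => Finset.sum_eq_zero fun b _ => ?_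
      rw [psiVec_some, phiVec_some, hi]
      by_cases hb : b = x i <;> simp [hb]
    · rw [if_pos hi, Finset.mul_sum, ← Finset.sum_neg_distrib, Complex.ofReal_sum]
      refine Finset.sum_congr rfl fun k _ => ?_
      rw [Finset.sum_eq_single (y i)]
      · rw [psiVec_some, phiVec_some, if_pos rfl, if_neg hi, ← hr, RCLike.inner_apply,
          Complex.conj_ofReal, ← Complex.ofReal_mul]
        congr 1
        field_simp
      · intro b _ hb
        rw [psiVec_some, if_neg hb, inner_zero_left]
      · simp
  simp only [Fintype.sum_prod_type]
  simp only [h1]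
  rw [← Complex.ofReal_sum, Finset.sum_neg_distrib, ← Finset.mul_sum, h]
  simp

end Vectors

/-! ### Facts about deciding vector sets -/

section DecidingFacts

variable {n m : ℕ} {X : Finset (Fin n → Bool)} {f : X → Bool}
  {v : X → Fin n → EuclideanSpace ℂ (Fin m)}

lemma sum_realify_mul (v : X → Fin n → EuclideanSpace ℂ (Fin m)) (x y : X) (j : Fin n) :
    ∑ k, realify v x j k * realify v y j k = (inner ℂ (v x j) (v y j)).re := by
  rw [Fintype.sum_sum_type, PiLp.inner_apply, Complex.re_sum, ← Finset.sum_add_distrib]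
  refine Finset.sum_congr rfl fun k _ => ?_
  simp [realify]
  ring

lemma sum_realify_sq (v : X → Fin n → EuclideanSpace ℂ (Fin m)) (x : X) (j : Fin n) :
    ∑ k, realify v x j k ^ 2 = ‖v x j‖ ^ 2 := by
  simp only [sq (realify v x j _), sum_realify_mul]
  rw [inner_self_eq_norm_sq_to_K]
  rw [← Complex.ofReal_re (‖v x j‖ ^ 2), Complex.ofReal_pow]
  rfl

lemma sum_norm_sq_le_vsSize (v : X → Fin n → EuclideanSpace ℂ (Fin m)) (x : X) :
    ∑ j, ‖v x j‖ ^ 2 ≤ vsSize v :=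
  le_ciSup (f := fun x : X => ∑ j, ‖v x j‖ ^ 2) (Set.finite_range _).bddAbove x

lemma IsDeciding.sum_realify (hv : IsDeciding f v) {x y : X} (h : f x ≠ f y) :
    ∑ j, (if x.1 j ≠ y.1 j then ∑ k, realify v x j k * realify v y j k else 0) = 1 := by
  have := congrArg Complex.re (hv x y h)
  rw [Complex.re_sum, Complex.one_re] at this
  rw [← this]
  refine Finset.sum_congr rfl fun j _ => ?_
  rw [sum_realify_mul]
  split_ifs <;> simp

lemma IsDeciding.one_le_vsSize (hv : IsDeciding f v) (hf : ∃ x y : X, f x ≠ f y) :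
    1 ≤ vsSize v := by
  obtain ⟨x, y, h⟩ := hf
  have h1 := hv.sum_realify h
  have h2 : ∑ j, (if x.1 j ≠ y.1 j then ∑ k, realify v x j k * realify v y j k else 0) ≤
      ∑ j, (‖v x j‖ ^ 2 + ‖v y j‖ ^ 2) / 2 := by
    refine Finset.sum_le_sum fun j _ => ?_
    split_ifs
    · rw [sum_realify_mul]
      have h3 := (Complex.re_le_norm _).trans (norm_inner_le_norm (𝕜 := ℂ) (v x j) (v y j))
      nlinarith [sq_nonneg (‖v x j‖ - ‖v y j‖)]
    · positivity
  rw [← Finset.sum_div, Finset.sum_add_distrib] at h2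
  have := sum_norm_sq_le_vsSize v x
  have := sum_norm_sq_le_vsSize v y
  linarith

lemma IsDeciding.exists_true_ne_zero (hv : IsDeciding f v) (hf : ∃ x y : X, f x ≠ f y) :
    ∃ x : X, f x = true ∧ ∃ j, v x j ≠ 0 := by
  obtain ⟨x, y, hx, h⟩ : ∃ x y : X, f x = true ∧ f x ≠ f y := by
    obtain ⟨x, y, h⟩ := hf
    cases hx : f x
    · exact ⟨y, x, by cases hy : f y <;> simp_all, h.symm⟩
    · exact ⟨x, y, hx, h⟩
  refine ⟨x, hx, ?_⟩
  by_contra! h0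
  have := hv x y h
  simp [h0] at this

lemma one_le_maxRank (hv : IsDeciding f v) (hf : ∃ x y : X, f x ≠ f y) : 1 ≤ maxRank f v := by
  obtain ⟨x, hx, j, hj⟩ := hv.exists_true_ne_zero hf
  refine le_trans ?_ (Finset.le_sup (Finset.mem_univ j))
  rw [Nat.one_le_iff_ne_zero, Ne, Submodule.finrank_eq_zero, Submodule.span_eq_bot]
  exact fun h => hj (h _ ⟨x, hx, rfl⟩)

lemma pos_of_exists_ne (hv : IsDeciding f v) (hf : ∃ x y : X, f x ≠ f y) : 0 < n := by
  obtain ⟨x, hx, j, hj⟩ := hv.exists_true_ne_zero hf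
  exact j.pos

lemma two_le_card (hf : ∃ x y : X, f x ≠ f y) : 2 ≤ X.card := by
  obtain ⟨x, y, h⟩ := hf
  have : 1 < Fintype.card X := Fintype.one_lt_card_iff.2 ⟨x, y, fun e => h (e ▸ rfl)⟩
  rwa [Fintype.card_coe] at this

lemma one_le_psiRank (c : ℝ) (hc : 0 < c) (hv : IsDeciding f v) (hf : ∃ x y : X, f x ≠ f y) :
    1 ≤ psiRank c f v := by
  obtain ⟨x, hx, -⟩ := hv.exists_true_ne_zero hf
  have hA := hv.one_le_vsSize hf
  rw [Nat.one_le_iff_ne_zero, psiRank, Ne, Submodule.finrank_eq_zero, Submodule.span_eq_bot]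
  intro h
  have h1 := norm_psiVec x.1 (realify v x) (c := c) (A := vsSize v) (by positivity)
  rw [h _ ⟨x, hx, rfl⟩, norm_zero] at h1
  exact zero_ne_one h1

lemma psiRank_le_card (c : ℝ) (f : X → Bool) (v : X → Fin n → EuclideanSpace ℂ (Fin m)) :
    psiRank c f v ≤ X.card := by
  have hsub : psiSet c f v ⊆ Set.range fun y : X => psiVec c (vsSize v) y.1 (realify v y) := by
    rintro ψ ⟨y, -, rfl⟩
    exact ⟨y, rfl⟩
  refine (Submodule.finrank_mono (Submodule.span_mono hsub)).trans ?_
  exact (finrank_range_le_card _).trans (by simp)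

/-- The real vector `Re w ⊕ Im w`, placed in the block `|i⟩|b⟩`. -/
def blockVec (i : Fin n) (b : Bool) (w : EuclideanSpace ℂ (Fin m)) :
    AdvSpace n (Fin m ⊕ Fin m) :=
  WithLp.toLp 2 fun s => s.elim 0 fun p => if p.1 = i ∧ p.2.2 = b then
    ((Sum.elim (fun k => (w k).re) (fun k => (w k).im) p.2.1 : ℝ) : ℂ) else 0

/-- Realification is only real-linear, so a complex combination of the `g l` needs both `g l` and `i
g l`. This doubles the rank. -/
lemma blockVec_mem_span {i : Fin n} {b : Bool} {d : ℕ} (g : Fin d → EuclideanSpace ℂ (Fin m))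
    (w : EuclideanSpace ℂ (Fin m)) (a : Fin d → ℂ) (hw : w = ∑ l, a l • g l) :
    blockVec i b w = ∑ l, (((a l).re : ℂ) • blockVec i b (g l) +
      ((a l).im : ℂ) • blockVec i b (Complex.I • g l)) := by
  ext s
  rcases s with _ | ⟨i', k | k, b'⟩
  · simp [blockVec]
  · by_cases h : i' = i ∧ b' = b
    · simp [blockVec, h, hw, Complex.re_sum, sub_eq_add_neg, Finset.sum_add_distrib]
    · simp [blockVec, h]
  · by_cases h : i' = i ∧ b' = b
    · simp [blockVec, h, hw, Complex.im_sum]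
    · simp [blockVec, h]

lemma psiVec_eq_sum_blockVec (c A : ℝ) (v : X → Fin n → EuclideanSpace ℂ (Fin m)) (y : X) :
    psiVec c A y.1 (realify v y) =
      psiVec c A y.1 (realify v y) none • zeroHat n (Fin m ⊕ Fin m) +
      ∑ i, (((√(1 + (c * A)⁻¹ * ∑ i, ∑ k, realify v y i k ^ 2))⁻¹ * (√(c * A))⁻¹ : ℝ) : ℂ) •
        blockVec i (y.1 i) (v y i) := by
  ext s
  rcases s with _ | ⟨i, k, b⟩
  · simp [zeroHat, blockVec]
  · rw [PiLp.add_apply, WithLp.ofLp_sum, Finset.sum_apply, Finset.sum_eq_single i]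
    · by_cases h : b = y.1 i
      · simp [zeroHat, blockVec, h, realify]
      · simp [zeroHat, blockVec, h]
    · intro i' _ hi'
      simp [blockVec, hi'.symm]
    · simp

/-- One dimension for `|0̂⟩`, and for each `j` a factor `2` from realification and `2` from the bit
`y_j`. -/
lemma psiRank_le (c : ℝ) (f : X → Bool) (v : X → Fin n → EuclideanSpace ℂ (Fin m)) :
    psiRank c f v ≤ 1 + 4 * n * maxRank f v := by
  set V : Fin n → Submodule ℂ (EuclideanSpace ℂ (Fin m)) := fun j =>
    Submodule.span ℂ {u | ∃ x : X, f x = true ∧ u = v x j} with hV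
  let g : ∀ j, Fin (Module.finrank ℂ (V j)) → EuclideanSpace ℂ (Fin m) := fun j l =>
    (Module.finBasis ℂ (V j) l : EuclideanSpace ℂ (Fin m))
  let G : Option (Σ j : Fin n, Fin (Module.finrank ℂ (V j)) × Bool × Bool) →
      AdvSpace n (Fin m ⊕ Fin m) := fun o => o.elim (zeroHat n _) fun p =>
    if p.2.2.2 then blockVec p.1 p.2.2.1 (Complex.I • g p.1 p.2.1)
    else blockVec p.1 p.2.2.1 (g p.1 p.2.1)
  have hsub : Submodule.span ℂ (psiSet c f v) ≤ Submodule.span ℂ (Set.range G) := by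
    rw [Submodule.span_le]
    rintro ψ ⟨y, hy, rfl⟩
    rw [SetLike.mem_coe, psiVec_eq_sum_blockVec]
    refine Submodule.add_mem _ (Submodule.smul_mem _ _ (Submodule.subset_span ⟨none, rfl⟩))
      (Submodule.sum_mem _ fun j _ => Submodule.smul_mem _ _ ?_)
    have hmem : v y j ∈ V j := Submodule.subset_span ⟨y, hy, rfl⟩
    rw [blockVec_mem_span (g j) (v y j) (fun l => (Module.finBasis ℂ (V j)).repr ⟨v y j, hmem⟩ l)
      (by
        have := congrArg Subtype.val ((Module.finBasis ℂ (V j)).sum_repr ⟨v y j, hmem⟩)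
        rw [AddSubmonoidClass.coe_finsetSum] at this
        exact this.symm)]
    refine Submodule.sum_mem _ fun l _ => Submodule.add_mem _ ?_ ?_
    · exact Submodule.smul_mem _ _ (Submodule.subset_span ⟨some ⟨j, l, y.1 j, false⟩, by simp [G]⟩)
    · exact Submodule.smul_mem _ _ (Submodule.subset_span ⟨some ⟨j, l, y.1 j, true⟩, by simp [G]⟩)
  refine (Submodule.finrank_mono hsub).trans ((finrank_range_le_card G).trans ?_)
  rw [Fintype.card_option, Fintype.card_sigma, add_comm]
  refine Nat.add_le_add_left ?_ 1
  calc _ ≤ ∑ _j : Fin n, 4 * maxRank f v := by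
        refine Finset.sum_le_sum fun j _ => ?_
        have : Module.finrank ℂ (V j) ≤ maxRank f v :=
          Finset.le_sup (f := fun j => Module.finrank ℂ (V j)) (Finset.mem_univ j)
        simp only [Fintype.card_prod, Fintype.card_fin, Fintype.card_bool]
        omega
    _ = _ := by simp; ring

end DecidingFacts

/-! ### Correctness on inputs of either value -/

section MainTheorem

variable {n m N : ℕ} {X : Finset (Fin n → Bool)} {f : X → Bool}
  {v : X → Fin n → EuclideanSpace ℂ (Fin m)}

/-- The vectors whose inner products the compression has to preserve: an orthonormal basis of
the span of the vectors `|ψ_y⟩`, the vectors `|ψ_y⟩` themselves, and the dual witnesses. -/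
def witnessFamily (c : ℝ) (f : X → Bool) (v : X → Fin n → EuclideanSpace ℂ (Fin m)) :
    Fin (psiRank c f v) ⊕ (X ⊕ X) → AdvSpace n (Fin m ⊕ Fin m) :=
  Sum.elim (fun l => (stdOrthonormalBasis ℂ (Submodule.span ℂ (psiSet c f v)) l : AdvSpace n _))
    (Sum.elim (fun y => psiVec c (vsSize v) y.1 (realify v y))
      fun x => phiVec c (vsSize v) x.1 (realify v x))

lemma span_compress_psiSet (c : ℝ) (S : Fin N → (Fin m ⊕ Fin m) → ℝ) :
    Submodule.span ℂ (compress S '' psiSet c f v) =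
      (Submodule.span ℂ (psiSet c f v)).map (compressLinear S) := by
  rw [Submodule.map_span]
  rfl

lemma norm_sq_compress_le {ι J : Type} [Fintype ι] {δ : ℝ} {z : J → AdvSpace n ι}
    {S : Fin N → ι → ℝ} (h : PreservesInner δ z S) (j : J) :
    ‖compress S (z j)‖ ^ 2 ≤ (1 + δ) * ‖z j‖ ^ 2 := by
  have h1 := h j j
  rw [inner_self_eq_norm_sq_to_K, inner_self_eq_norm_sq_to_K] at h1
  have h2 : ‖((‖compress S (z j)‖ : ℂ) ^ 2 - (‖z j‖ : ℂ) ^ 2)‖ =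
      |‖compress S (z j)‖ ^ 2 - ‖z j‖ ^ 2| := by
    rw [← Real.norm_eq_abs, ← Complex.norm_real]
    push_cast
    rfl
  have h3 : |‖compress S (z j)‖ ^ 2 - ‖z j‖ ^ 2| ≤ δ * (‖z j‖ * ‖z j‖) := h2 ▸ h1
  have := le_abs_self (‖compress S (z j)‖ ^ 2 - ‖z j‖ ^ 2)
  nlinarith

lemma phaseEstProb_compressed_of_true (hA : 1 ≤ vsSize v) {S : Fin N → (Fin m ⊕ Fin m) → ℝ}
    {δ : ℝ} (hδ : δ ≤ 1 / 10) (hS : PreservesInner δ (witnessFamily 100 f v) S)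
    {M : ℕ} (hM : 0 < M) {x : X} (hx : f x = true) :
    2 / 3 ≤ phaseEstProb M (compressedUnitary 100 f v S x.1) (zeroHat n (Fin N)) 0 := by
  set ψ := psiVec 100 (vsSize v) x.1 (realify v x) with hψ
  have hcA : 0 < 100 * vsSize v := by linarith
  have hV : compress S ψ ∈ Submodule.span ℂ (compress S '' psiSet 100 f v) :=
    Submodule.subset_span ⟨ψ, ⟨x, hx, rfl⟩, rfl⟩
  have h1 := phaseEstProb_twoReflections_ge x.1 _ hM hV
    (by rw [compress_inputProj, inputProj_psiVec]) (zeroHat n (Fin N))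
  have h2 := norm_sq_compress_le hS (Sum.inr (Sum.inl x))
  have h3 : witnessFamily 100 f v (Sum.inr (Sum.inl x)) = ψ := rfl
  rw [h3, norm_psiVec x.1 _ hcA] at h2
  set ν := 1 + (100 * vsSize v)⁻¹ * ∑ i, ∑ k, realify v x i k ^ 2 with hν
  have hsum : ∑ i, ∑ k, realify v x i k ^ 2 ≤ vsSize v := by
    simp only [sum_realify_sq]
    exact sum_norm_sq_le_vsSize v x
  have hν1 : ν ≤ 101 / 100 := by
    have : (100 * vsSize v)⁻¹ * ∑ i, ∑ k, realify v x i k ^ 2 ≤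
        (100 * vsSize v)⁻¹ * vsSize v := by gcongr
    have h4 : (100 * vsSize v)⁻¹ * vsSize v = 1 / 100 := by
      have : vsSize v ≠ 0 := by linarith
      field_simp
    linarith
  have hν0 : 0 < ν := by positivity
  have hinner : ‖inner ℂ (compress S ψ) (zeroHat n (Fin N))‖ ^ 2 = ν⁻¹ := by
    rw [zeroHat, EuclideanSpace.inner_single_right, compress_none, hψ, psiVec_none, one_mul,
      RCLike.norm_conj, Complex.norm_real, Real.norm_eq_abs, sq_abs, inv_pow, ← hν,
      Real.sq_sqrt hν0.le]
  rw [hinner] at h1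
  have h5 : (101 / 100 : ℝ)⁻¹ ≤ ν⁻¹ := inv_anti₀ hν0 hν1
  set p := phaseEstProb M (twoReflections x.1 _) (zeroHat n (Fin N)) 0 with hp
  have hp0 : 0 ≤ p := by rw [hp, phaseEstProb]; positivity
  have h6 : ‖compress S ψ‖ ^ 2 * p ≤ 11 / 10 * p := by
    gcongr
    linarith
  -- The compressed unitary is `twoReflections` by definition; `p ≥ 1 / (1.01 · 1.1)`.
  change 2 / 3 ≤ p
  norm_num at h5
  linarith

lemma phaseEstProb_compressed_of_false (hv : IsDeciding f v) (hA : 1 ≤ vsSize v)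
    {S : Fin N → (Fin m ⊕ Fin m) → ℝ} {δ : ℝ} (hδ : δ ≤ 1 / 10)
    (hδd : δ * psiRank 100 f v ≤ 1 / 2)
    (hδA : δ ^ 2 * (psiRank 100 f v * vsSize v ^ 2) ≤ 1 / 4000)
    (hS : PreservesInner δ (witnessFamily 100 f v) S)
    {M : ℕ} (hM : 100 * vsSize v ≤ M) {x : X} (hx : f x = false) :
    phaseEstProb M (compressedUnitary 100 f v S x.1) (zeroHat n (Fin N)) 0 ≤ 1 / 3 := by
  set A := vsSize v with hAdef
  set φ := phiVec 100 A x.1 (realify v x) with hφ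
  set e := stdOrthonormalBasis ℂ (Submodule.span ℂ (psiSet 100 f v)) with he
  have hM' : (0 : ℝ) < M := by linarith
  have hcA : 0 < 100 * A := by linarith
  have hsum : ∑ i, ∑ k, realify v x i k ^ 2 ≤ A := by
    simp only [sum_realify_sq]
    exact sum_norm_sq_le_vsSize v x
  have hφ2 : ‖φ‖ ^ 2 ≤ 101 * A ^ 2 := by
    rw [hφ, norm_sq_phiVec x.1 _ hcA]
    nlinarith [mul_le_mul_of_nonneg_left hsum hcA.le]
  have horth : ∀ ψ ∈ Submodule.span ℂ (psiSet 100 f v), inner ℂ ψ φ = 0 := by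
    intro ψ hψ
    induction hψ using Submodule.span_induction with
    | mem ψ h =>
      obtain ⟨y, hy, rfl⟩ := h
      exact inner_psiVec_phiVec y.1 _ hcA x.1 _ (hv.sum_realify (by rw [hy, hx]; decide))
    | zero => exact inner_zero_left _
    | add a b _ _ ha hb => rw [inner_add_left, ha, hb, add_zero]
    | smul a b _ hb => rw [inner_smul_left, hb, mul_zero]
  have hnorm_e : ∀ l, ‖(e l : AdvSpace n (Fin m ⊕ Fin m))‖ = 1 := fun l => e.orthonormal.1 l
  have hw : ∀ l, ‖inner ℂ (compressLinear S (e l : AdvSpace n (Fin m ⊕ Fin m)))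
      (compress S φ)‖ ≤ δ * ‖φ‖ := by
    intro l
    have h1 : ‖inner ℂ (compress S (e l : AdvSpace n (Fin m ⊕ Fin m))) (compress S φ) -
        inner ℂ (e l : AdvSpace n (Fin m ⊕ Fin m)) φ‖ ≤
        δ * (‖(e l : AdvSpace n (Fin m ⊕ Fin m))‖ * ‖φ‖) :=
      hS (Sum.inl l) (Sum.inr (Sum.inr x))
    rw [horth _ (e l).2, sub_zero, hnorm_e, one_mul] at h1
    exact h1
  have hproj : ‖(Submodule.span ℂ (compress S '' psiSet 100 f v)).starProjection
      (compress S φ)‖ ^ 2 ≤ 2 * psiRank 100 f v * (δ * ‖φ‖) ^ 2 := by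
    rw [span_compress_psiSet]
    refine norm_sq_starProjection_map_le e (compressLinear S) hδd (fun l l' => ?_) _ hw
    have h1 : ‖inner ℂ (compress S (e l : AdvSpace n (Fin m ⊕ Fin m)))
        (compress S (e l' : AdvSpace n (Fin m ⊕ Fin m))) -
        inner ℂ (e l : AdvSpace n (Fin m ⊕ Fin m)) (e l' : AdvSpace n (Fin m ⊕ Fin m))‖ ≤
        δ * (‖(e l : AdvSpace n (Fin m ⊕ Fin m))‖ * ‖(e l' : AdvSpace n (Fin m ⊕ Fin m))‖) :=
      hS (Sum.inl l) (Sum.inl l')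
    rw [hnorm_e, hnorm_e, one_mul, mul_one] at h1
    exact h1
  have hproj' : ‖(Submodule.span ℂ (compress S '' psiSet 100 f v)).starProjection
      (compress S φ)‖ ≤ 1 / 4 := by
    refine (pow_le_pow_iff_left₀ (norm_nonneg _) (by norm_num) two_ne_zero).1 (hproj.trans ?_)
    have h1 : 2 * (psiRank 100 f v : ℝ) * (δ * ‖φ‖) ^ 2 ≤
        2 * psiRank 100 f v * (δ ^ 2 * (101 * A ^ 2)) := by
      rw [mul_pow]; gcongr
    -- `2 · 101 / 4000 ≤ 1 / 16`.
    linarith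
  have hcφ : ‖compress S φ‖ ≤ 13 * A := by
    have h1 : ‖compress S φ‖ ^ 2 ≤ (1 + δ) * ‖φ‖ ^ 2 :=
      norm_sq_compress_le hS (Sum.inr (Sum.inr x))
    refine (pow_le_pow_iff_left₀ (norm_nonneg _) (by linarith) two_ne_zero).1 (h1.trans ?_)
    have h2 : (1 + δ) * ‖φ‖ ^ 2 ≤ 11 / 10 * ‖φ‖ ^ 2 := by gcongr; linarith
    nlinarith [sq_nonneg A]
  have hratio : ‖compress S φ‖ / M ≤ 13 / 100 := by
    rw [div_le_iff₀ hM']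
    linarith
  have hz : inputProj x.1 (compress S φ) = zeroHat n (Fin N) := by
    rw [compress_inputProj, inputProj_phiVec, compress_zeroHat]
  have h1 := phaseEstProb_twoReflections_le x.1
    (Submodule.span ℂ (compress S '' psiSet 100 f v)) (Nat.cast_pos.1 hM') (compress S φ)
  rw [hz] at h1
  refine h1.trans ?_
  calc _ ≤ (13 / 100 + 1 / 4 : ℝ) ^ 2 := by gcongr
    _ ≤ 1 / 3 := by norm_num

lemma exists_queryAlgorithm_of_preservesInner (hv : IsDeciding f v) (hf : ∃ x y : X, f x ≠ f y)
    {S : Fin N → (Fin m ⊕ Fin m) → ℝ} {δ : ℝ} (hδ : δ ≤ 1 / 10)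
    (hδd : δ * psiRank 100 f v ≤ 1 / 2)
    (hδA : δ ^ 2 * (psiRank 100 f v * vsSize v ^ 2) ≤ 1 / 4000)
    (hS : PreservesInner δ (witnessFamily 100 f v) S)
    {M : ℕ} (hM : 100 * vsSize v ≤ M) :
    ∃ Q : QueryAlgorithm n,
      (∀ x : Fin n → Bool, Q.outputProb x true =
        phaseEstProb M (compressedUnitary 100 f v S x) (zeroHat n (Fin N)) 0) ∧
      (∀ x : X, 2 / 3 ≤ Q.outputProb x.1 (f x)) ∧
      Q.queries = 2 * M ∧
      Q.qubits = Nat.clog 2 (n * (2 * (M * (N + 1)))) := by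
  have hA := hv.one_le_vsSize hf
  have hM0 : 0 < M := by
    have : (0 : ℝ) < M := by linarith
    exact_mod_cast this
  obtain ⟨Q, hq, hcard, hQ⟩ := exists_queryAlgorithm_phaseEst (pos_of_exists_ne hv hf) hM0
    (Submodule.span ℂ (compress S '' psiSet 100 f v))
  refine ⟨Q, hQ, fun x => ?_, hq, by rw [QueryAlgorithm.qubits, hcard]⟩
  cases hx : f x
  · have h1 := phaseEstProb_compressed_of_false hv hA hδ hδd hδA hS hM hx
    have h2 := Q.outputProb_add x.1
    have h3 : Q.outputProb x.1 true ≤ 1 / 3 := (hQ x.1).le.trans h1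
    linarith
  · exact (phaseEstProb_compressed_of_true hA hδ hS hM0 hx).trans (hQ x.1).ge

end MainTheorem

/-! ### Choice of the accuracy and the dimensions -/

section Parameters

variable {n m N : ℕ} {X : Finset (Fin n → Bool)} {f : X → Bool}
  {v : X → Fin n → EuclideanSpace ℂ (Fin m)}

lemma jlMeasure_not_preservesInner_witnessFamily_le (hn : 0 < n) (hX : 2 ≤ X.card) {R : ℝ}
    (hR : 1 ≤ R) (hN : 20160000 * (R * Real.log (X.card * n)) ≤ N) :
    jlMeasure N (Fin m ⊕ Fin m)
      {S | ¬ PreservesInner (4 * (300 * √R)⁻¹) (witnessFamily 100 f v) S} ≤ 1 / 10 := by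
  set Z : ℝ := X.card * n with hZ
  have hn1 : (1 : ℝ) ≤ n := by exact_mod_cast hn
  have hX2 : (2 : ℝ) ≤ X.card := by exact_mod_cast hX
  have hZ2 : 2 ≤ Z := by nlinarith
  have hlog : 0 < Real.log Z := Real.log_pos (by linarith)
  have hR0 : 0 < √R := Real.sqrt_pos.2 (by linarith)
  have hN0 : (0 : ℝ) < N := lt_of_lt_of_le (by positivity) hN
  set ε : ℝ := (300 * √R)⁻¹ with hε
  have hε0 : 0 < ε := by positivity
  have hε1 : ε ≤ 1 := inv_le_one_of_one_le₀ (by nlinarith [Real.one_le_sqrt.2 hR])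
  have hε2 : ε ^ 2 = (90000 * R)⁻¹ := by
    rw [hε, inv_pow, mul_pow, Real.sq_sqrt (by linarith)]; norm_num
  have htail := jlMeasure_not_preservesInner_le (Nat.cast_pos.1 hN0) hε0 hε1
    (witnessFamily 100 f v)
  -- `20160000 = 14 · 16 · 90000`. The failure probability is then at most `288 Z^{-12}`, and `Z ≥
  -- 2`.
  have hexp : 14 * Real.log Z ≤ N * ε ^ 2 / 16 := by
    rw [hε2, le_div_iff₀ (by norm_num), ← div_eq_mul_inv, le_div_iff₀ (by positivity)]
    linarith
  have hcard : ((Fintype.card (Fin (psiRank 100 f v) ⊕ (X ⊕ X)) : ℕ) : ℝ) ≤ 3 * X.card := by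
    have := psiRank_le_card 100 f v
    simp only [Fintype.card_sum, Fintype.card_fin, Fintype.card_coe]
    norm_cast
    omega
  have hreal : (jlMeasure N (Fin m ⊕ Fin m)).real
      {S | ¬ PreservesInner (4 * ε) (witnessFamily 100 f v) S} ≤ 1 / 10 := by
    refine htail.trans ?_
    have h1 : Real.exp (-(N * ε ^ 2 / 16)) ≤ (Z ^ 14)⁻¹ := by
      rw [← Real.exp_log (by positivity : 0 < (Z ^ 14)⁻¹), Real.log_inv, Real.log_pow]
      apply Real.exp_le_exp.2
      push_cast
      linarith
    calc _ ≤ 32 * (n * (3 * X.card) ^ 2) * (Z ^ 14)⁻¹ := by gcongr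
      _ ≤ 288 * Z ^ 2 * (Z ^ 14)⁻¹ := by
        refine mul_le_mul_of_nonneg_right ?_ (by positivity)
        rw [hZ]
        have : (n : ℝ) ≤ n ^ 2 := by nlinarith
        nlinarith [sq_nonneg (X.card : ℝ)]
      _ = 288 * (Z ^ 12)⁻¹ := by
        field_simp
      _ ≤ 288 * (2 ^ 12)⁻¹ := by gcongr
      _ ≤ 1 / 10 := by norm_num
  rw [← ofReal_measureReal]
  refine (ENNReal.ofReal_le_ofReal hreal).trans ?_
  rw [ENNReal.ofReal_div_of_pos (by norm_num)]
  simp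

/-- With `q = 2 κ n` in mind, the dimension is at most a constant times `K^5 q^8`. Since `log₂ q ≥
1`, the constant is absorbed as a factor, and the `9` is the degree `8` plus one for the ceiling. -/
lemma clog_card_le {K A R q : ℝ} {n M N d : ℕ} {Z : ℝ} (hK : 1 ≤ K) (hn : 0 < n) (hM0 : 0 < M)
    (hq : 2 ≤ q) (hnq : 2 * n ≤ q) (hA : 1 ≤ A) (hAK : A ≤ K * n) (hM : M ≤ 101 * A)
    (hd : d ≤ 3 * q) (hR : R = d ^ 2 + A ^ 4 * d) (hlog : Real.log Z ≤ 2 * n)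
    (hN : N + 1 ≤ 20160002 * (R * Real.log Z)) :
    (Nat.clog 2 (n * (2 * (M * (N + 1)))) : ℝ) ≤
      (Real.logb 2 (50000000000 * K ^ 5) + 9) * Real.logb 2 q := by
  have hq0 : 0 < q := by linarith
  have hAq : A ≤ K * q := hAK.trans (by gcongr; linarith)
  have hRq : R ≤ 12 * K ^ 4 * q ^ 5 := by
    rw [hR]
    calc (d : ℝ) ^ 2 + A ^ 4 * d ≤ (3 * q) ^ 2 + (K * q) ^ 4 * (3 * q) := by gcongr
      _ = 9 * (1 * q ^ 2) + 3 * (K ^ 4 * q ^ 5) := by ring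
      _ ≤ 9 * (K ^ 4 * q ^ 5) + 3 * (K ^ 4 * q ^ 5) := by
        gcongr
        · exact one_le_pow₀ hK
        · linarith
        · norm_num
      _ = _ := by ring
  have hR0 : 0 ≤ R := by rw [hR]; positivity
  have hN' : (N : ℝ) + 1 ≤ 20160002 * (12 * K ^ 4 * q ^ 5 * q) := by
    have h1 : R * Real.log Z ≤ R * q := mul_le_mul_of_nonneg_left (hlog.trans hnq) hR0
    have h2 : R * q ≤ 12 * K ^ 4 * q ^ 5 * q := by gcongr
    linarith
  have hcard : ((n * (2 * (M * (N + 1))) : ℕ) : ℝ) ≤ 50000000000 * K ^ 5 * q ^ 8 := by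
    push_cast
    calc (n : ℝ) * (2 * (M * (N + 1))) = (2 * n) * (M * (N + 1)) := by ring
      _ ≤ q * (101 * (K * q) * (20160002 * (12 * K ^ 4 * q ^ 5 * q))) := by
        gcongr
        exact hM.trans (by gcongr)
      _ = 24433922424 * (K ^ 5 * q ^ 8) := by ring
      _ ≤ 50000000000 * (K ^ 5 * q ^ 8) := by gcongr; norm_num
      _ = _ := by ring
  have hpos : (0 : ℝ) < ((n * (2 * (M * (N + 1))) : ℕ) : ℝ) := by positivity
  have hlogq : 1 ≤ Real.logb 2 q := by
    rw [← Real.logb_self_eq_one (b := 2) (by norm_num)]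
    exact Real.logb_le_logb_of_le (by norm_num) (by norm_num) hq
  have hB : 0 ≤ Real.logb 2 (50000000000 * K ^ 5) :=
    Real.logb_nonneg (by norm_num) (by nlinarith [one_le_pow₀ hK (n := 5)])
  have h1 := Real.logb_le_logb_of_le (b := 2) (by norm_num) hpos hcard
  rw [Real.logb_mul (by positivity) (by positivity), Real.logb_pow] at h1
  have hge : 0 ≤ Real.logb 2 ((n * (2 * (M * (N + 1))) : ℕ) : ℝ) :=
    Real.logb_nonneg (by norm_num) (by exact_mod_cast hpos)
  rw [← Real.natCeil_logb_natCast]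
  have h2 := (Nat.ceil_lt_add_one hge).le
  push_cast at h1 h2 ⊢
  nlinarith

end Parameters

end

theorem mainTheorem2 :
    ∃ C : ℝ, ∀ K : ℝ, ∃ D : ℝ,
      ∀ (n m : ℕ) (X : Finset (Fin n → Bool)) (f : X → Bool)
        (v : X → Fin n → EuclideanSpace ℂ (Fin m)),
        IsDeciding f v → (∃ x y : X, f x ≠ f y) → vsSize v ≤ K * n →
        ∃ M N : ℕ,
          (M : ℝ) ≤ C * vsSize v ∧
          (N : ℝ) ≤ C * (((psiRank 100 f v : ℝ) ^ 2 + vsSize v ^ 4 * psiRank 100 f v) *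
            Real.log (X.card * n)) ∧
          jlMeasure N (Fin m ⊕ Fin m) {S | ¬ ∃ Q : QueryAlgorithm n,
            (∀ x : Fin n → Bool, Q.outputProb x true =
              phaseEstProb M (compressedUnitary 100 f v S x) (zeroHat n (Fin N)) 0) ∧
            (∀ x : X, 2 / 3 ≤ Q.outputProb x.1 (f x)) ∧
            (Q.queries : ℝ) ≤ C * vsSize v ∧
            (Q.qubits : ℝ) ≤ D * Real.logb 2 (2 * maxRank f v * n)} ≤ 1 / 10 := by
  -- `K` enters only the qubit bound, and `max K 1` allows it to be taken at least `1`. The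
  -- universal constant is dominated by that of `N`.
  refine ⟨30000000, fun K => ⟨Real.logb 2 (50000000000 * max K 1 ^ 5) + 9, ?_⟩⟩
  intro n m X f v hv hf hK
  have hA := hv.one_le_vsSize hf
  have hn := pos_of_exists_ne hv hf
  have hX := two_le_card hf
  have hκ := one_le_maxRank hv hf
  have hd := one_le_psiRank 100 (by norm_num) hv hf
  set A := vsSize v with hAdef
  set d := psiRank 100 f v with hddef
  set κ := maxRank f v with hκdef
  set Z : ℝ := X.card * n with hZ
  set R : ℝ := (d : ℝ) ^ 2 + A ^ 4 * d with hR
  have hn1 : (1 : ℝ) ≤ n := by exact_mod_cast hn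
  have hX2 : (2 : ℝ) ≤ X.card := by exact_mod_cast hX
  have hd1 : (1 : ℝ) ≤ d := by exact_mod_cast hd
  have hκ1 : (1 : ℝ) ≤ κ := by exact_mod_cast hκ
  have hZ2 : 2 ≤ Z := by nlinarith
  have hA24 : A ^ 2 ≤ A ^ 4 := pow_le_pow_right₀ hA (by norm_num)
  have hA4 : 1 ≤ A ^ 4 := one_le_pow₀ hA
  -- The accuracy `δ = 4 / (300 √R)` needs `d ≤ √R` for the Gram matrix and `d A² ≤ R` for the
  -- projection of the dual witness.
  have hdR : (d : ℝ) ^ 2 ≤ R := by rw [hR]; nlinarith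
  have hdA : (d : ℝ) * A ^ 2 ≤ R := by rw [hR]; nlinarith [sq_nonneg (d : ℝ)]
  have hR2 : 2 ≤ R := by rw [hR]; nlinarith
  have hlog2 : (1 / 2 : ℝ) ≤ Real.log Z := by
    have := Real.log_le_log (by norm_num) hZ2
    linarith [Real.log_two_gt_d9]
  have hRZ : 1 ≤ R * Real.log Z := by nlinarith
  have hlogZ : Real.log Z ≤ 2 * n := by
    have hX' : (X.card : ℝ) ≤ 2 ^ n := by
      have := X.card_le_univ
      simp only [Fintype.card_pi, Fintype.card_bool, Finset.prod_const, Finset.card_univ,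
        Fintype.card_fin] at this
      exact_mod_cast this
    rw [hZ, Real.log_mul (by positivity) (by positivity)]
    have h1 := Real.log_le_log (by positivity) hX'
    rw [Real.log_pow] at h1
    have h2 := Real.log_le_sub_one_of_pos (by positivity : (0 : ℝ) < n)
    nlinarith [Real.log_two_lt_d9]
  have hM1 : 100 * A ≤ (⌈100 * A⌉₊ : ℝ) := Nat.le_ceil _
  have hM2 : (⌈100 * A⌉₊ : ℝ) ≤ 101 * A := by
    have := Nat.ceil_lt_add_one (by positivity : 0 ≤ 100 * A)
    linarith
  have hN1 := Nat.le_ceil (20160000 * (R * Real.log Z))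
  have hN2 := Nat.ceil_lt_add_one (by positivity : 0 ≤ 20160000 * (R * Real.log Z))
  have hM0 : 0 < ⌈100 * A⌉₊ := Nat.ceil_pos.2 (by linarith)
  refine ⟨⌈100 * A⌉₊, ⌈20160000 * (R * Real.log Z)⌉₊, by linarith, by linarith, ?_⟩
  refine (measure_mono ?_).trans
    (jlMeasure_not_preservesInner_witnessFamily_le (f := f) (v := v) hn hX (by linarith) hN1)
  intro S hS
  rw [Set.mem_ofPred_eq] at hS ⊢
  intro hgood
  apply hS
  have hR0 : 0 < √R := Real.sqrt_pos.2 (by linarith)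
  have hR1 : 1 ≤ √R := Real.one_le_sqrt.2 (by linarith)
  have hδ : 4 * (300 * √R)⁻¹ ≤ (1 / 10 : ℝ) := by
    rw [← div_eq_mul_inv, div_le_iff₀ (by positivity)]
    linarith
  have hδd : 4 * (300 * √R)⁻¹ * d ≤ (1 / 2 : ℝ) := by
    have : (d : ℝ) ≤ √R := Real.le_sqrt_of_sq_le hdR
    rw [mul_right_comm, ← div_eq_mul_inv, div_le_iff₀ (by positivity)]
    linarith
  have hδA : (4 * (300 * √R)⁻¹) ^ 2 * (d * A ^ 2) ≤ (1 / 4000 : ℝ) := by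
    rw [mul_pow, inv_pow, mul_pow, Real.sq_sqrt (by linarith), mul_right_comm, ← div_eq_mul_inv,
      div_le_iff₀ (by positivity)]
    linarith
  obtain ⟨Q, hQ1, hQ2, hQ3, hQ4⟩ :=
    exists_queryAlgorithm_of_preservesInner hv hf hδ hδd hδA hgood hM1
  refine ⟨Q, hQ1, hQ2, ?_, ?_⟩
  · rw [hQ3]
    push_cast
    linarith
  · rw [hQ4]
    have hnκ : (n : ℝ) ≤ κ * n := le_mul_of_one_le_left (by positivity) hκ1
    -- With `q = 2 κ n` this is `1 + 2 q ≤ 3 q`.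
    have hd3 : (d : ℝ) ≤ 1 + 4 * n * κ := by exact_mod_cast psiRank_le 100 f v
    refine clog_card_le (le_max_right K 1) hn hM0 ?_ ?_ hA
      (hK.trans (by gcongr; exact le_max_left _ _)) hM2 ?_ hR hlogZ (by linarith)
    · nlinarith
    · nlinarith
    · nlinarith
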